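/- Let $\mathbb T=\mathbb R/\mathbb Z$ and let $f:\mathbb T\to\mathbb R$ be Lipschitz. For $\alpha\in\mathbb R$ and $\theta\in\mathbb T$ let $H_{\alpha,\theta}$ be the bounded self-adjoint operator on $\ell^2(\mathbb Z)$ given by $$(H_{\alpha,\theta}\psi)(n)=\psi(n-1)+\psi(n+1)+f(\theta+n\alpha)\psi(n),$$ and let $\mu_{\alpha,\theta}=\mu_{\delta_0,\delta_0}+\mu_{\delta_1,\delta_1}$ be its canonical spectral measure, where $\mu_{\phi,\phi}$ is the Borel measure on $\mathbb R$ with $\langle\phi,g(H_{\alpha,\theta})\phi\rangle=\int g\,d\mu_{\phi,\phi}$ and $\delta_k$ is the $k$-th canonical basis vector of $\ell^2(\mathbb Z)$. Fix an irrational $\alpha$, let $\sigma_\alpha$ be the spectrum of $H_{\alpha,\theta}$ (which does not depend on $\theta$), and let $$\gamma(E)=\lim_{n\to\infty}\frac1n\int_{\mathbb T}\log\|T_{\theta,E}(n-1)\cdots T_{\theta,E}(0)\|\,d\theta,\qquad T_{\theta,E}(k)=\begin{pmatrix}E-f(\theta+k\alpha)&-1\\1&0\end{pmatrix},$$ be the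 Lyapunov exponent. Assume that $\gamma$ is continuous on $\mathbb R$. For a rational $p/q$ with $q\ge1$ and for $\varkappa\in\mathbb R$ let $A_{p/q,\theta}(\varkappa)$ be the Floquet matrix: the Hermitian $q\times q$ matrix with rows and columns indexed by the integers $l\in(-q/2,q/2]$, with diagonal entries $f(\theta+lp/q)$, entries $1$ between neighbouring indices, and entry $e^{iq\varkappa}$, respectively $e^{-iq\varkappa}$, in the (first row, last column), respectively (last row, first column), corner (where these positions coincide, for $q\le2$, the entries are added). Let $\lambda_j$, $\Psi^{(j)}$ ($1\le j\le q$) be its eigenvalues and an orthonormal basis of corresponding eigenvectors, and let $$\mu^{(\varkappa)}_{p/q,\theta}=\sum_{j=1}^q\big(|\langle\Psi^{(j)},e_0\rangle|^2+|\langle\Psi^{(j)},e_1\rangle|^2\big)\,\delta_{\lambda_j},$$ where $e_0,e_1$ are the canonical basis vectors of $\mathbb C^q$ at the indices $0,1$ (modulo $q$). Let $E_0\in\sigma_\alpha$, $\varepsilon>0$ and $B_\varepsilon(E_0)=(E_0-\varepsilon,E_0+\varepsilon)$, let $\beta>2\sup_{E\in B_\varepsilon(E_0)}\gamma(E)$,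 and let $\alpha_m=p_m/q_m\to\alpha$ be a sequence of rationals with $|\alpha-\alpha_m|<e^{-\beta q_m}$ for every $m$. Then 1. $\displaystyle\lim_{m\to\infty}\ \sup_{\theta\in\mathbb T}\ \sup_{\varkappa\in[0,\pi/q_m]}\Big|\mu^{(\varkappa)}_{\alpha_m,\theta}(B_\varepsilon(E_0))-\mu_{\alpha,\theta}(B_\varepsilon(E_0))\Big|=0$; 2. $\theta\mapsto\mu_{\alpha,\theta}(B_\varepsilon(E_0))$ is continuous on $\mathbb T$. -/

import Mathlib

open Filter Topology MeasureTheory Set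
open scoped ENNReal NNReal BoundedContinuousFunction CompactlySupported

noncomputable section

namespace QPS

/-! ### Discrete Schrödinger operators on `ℓ²(ℤ)` -/

/-- The Hilbert space `ℓ²(ℤ)` of square-summable complex sequences. -/
abbrev L2Z : Type := lp (fun _ : ℤ => ℂ) 2

/-- The canonical basis vector `δ_k` of `ℓ²(ℤ)`. -/
def delta (k : ℤ) : L2Z := lp.single 2 k (1 : ℂ)

theorem memlp_translate (k : ℤ) (ψ : L2Z) : Memℓp (fun n : ℤ => ψ (n + k)) 2 := by
  have h := (memℓp_gen_iff (p := 2) (by norm_num)).1 (lp.memℓp ψ)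
  exact (memℓp_gen_iff (p := 2) (by norm_num)).2
    ((Equiv.addRight k).summable_iff (f := fun n : ℤ => ‖ψ n‖ ^ (2 : ℝ≥0∞).toReal) |>.2 h)

theorem memlp_mul (V : ℤ →ᵇ ℝ) (ψ : L2Z) : Memℓp (fun n : ℤ => (V n : ℂ) * ψ n) 2 := by
  have h := (memℓp_gen_iff (p := 2) (by norm_num)).1 (lp.memℓp ψ)
  refine (memℓp_gen_iff (p := 2) (by norm_num)).2
    (Summable.of_nonneg_of_le (fun n => by positivity) (fun n => ?_)
      (h.mul_left (‖V‖ ^ (2 : ℝ≥0∞).toReal)))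
  rw [norm_mul, ← Real.mul_rpow (norm_nonneg _) (norm_nonneg _)]
  gcongr
  simpa using V.norm_coe_le_norm n

/-- The translation `(ψ ↦ ψ(· + k))` on `ℓ²(ℤ)`. -/
def translate (k : ℤ) : L2Z →L[ℂ] L2Z :=
  LinearMap.mkContinuous
    { toFun := fun ψ => ⟨fun n => ψ (n + k), memlp_translate k ψ⟩
      map_add' := fun _ _ => by ext n; rfl
      map_smul' := fun _ _ => by ext n; rfl } 1 (fun ψ => by
    refine lp.norm_le_of_tsum_le (p := 2) (by norm_num) (by positivity) ?_
    rw [one_mul, lp.norm_rpow_eq_tsum (by norm_num)]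
    exact ((Equiv.addRight k).tsum_eq (fun n : ℤ => ‖ψ n‖ ^ (2 : ℝ≥0∞).toReal)).le)

/-- Multiplication by a bounded real potential on `ℓ²(ℤ)`. -/
def mulPotential (V : ℤ →ᵇ ℝ) : L2Z →L[ℂ] L2Z :=
  LinearMap.mkContinuous
    { toFun := fun ψ => ⟨fun n => (V n : ℂ) * ψ n, memlp_mul V ψ⟩
      map_add' := fun ψ φ => by ext n; exact mul_add (V n : ℂ) (ψ n) (φ n)
      map_smul' := fun c ψ => by ext n; exact mul_left_comm (V n : ℂ) c (ψ n) } ‖V‖ (fun ψ => by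
    have h := (memℓp_gen_iff (p := 2) (by norm_num)).1 (lp.memℓp ψ)
    have h' := (memℓp_gen_iff (p := 2) (by norm_num)).1 (memlp_mul V ψ)
    refine lp.norm_le_of_tsum_le (p := 2) (by norm_num) (by positivity) ?_
    rw [Real.mul_rpow (norm_nonneg _) (norm_nonneg _), lp.norm_rpow_eq_tsum (by norm_num),
      ← tsum_mul_left]
    refine h'.tsum_le_tsum (fun n => ?_) (h.mul_left _)
    change ‖(V n : ℂ) * ψ n‖ ^ (2 : ℝ≥0∞).toReal ≤ _
    rw [norm_mul, ← Real.mul_rpow (norm_nonneg _) (norm_nonneg _)]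
    gcongr
    simpa using V.norm_coe_le_norm n)

/-- The discrete Schrödinger operator
`(Hψ)(n) = ψ(n-1) + ψ(n+1) + V(n) ψ(n)` on `ℓ²(ℤ)`. -/
def schrodinger (V : ℤ →ᵇ ℝ) : L2Z →L[ℂ] L2Z :=
  translate (-1) + translate 1 + mulPotential V

theorem schrodinger_apply (V : ℤ →ᵇ ℝ) (ψ : L2Z) (n : ℤ) :
    schrodinger V ψ n = ψ (n - 1) + ψ (n + 1) + V n * ψ n := rfl

theorem schrodinger_isSelfAdjoint (V : ℤ →ᵇ ℝ) : IsSelfAdjoint (schrodinger V) := by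
  have ht : ∀ (k : ℤ) (ψ φ : L2Z),
      inner ℂ (translate k ψ) φ = inner ℂ ψ (translate (-k) φ) := by
    intro k ψ φ
    rw [lp.inner_eq_tsum, lp.inner_eq_tsum,
      ← (Equiv.addRight k).tsum_eq (fun n : ℤ => inner ℂ (ψ n) (translate (-k) φ n))]
    refine tsum_congr fun n => ?_
    change inner ℂ (ψ (n + k)) (φ n) = inner ℂ (ψ (n + k)) (φ (n + k + -k))
    rw [add_neg_cancel_right]
  have hm : ∀ ψ φ : L2Z, inner ℂ (mulPotential V ψ) φ = inner ℂ ψ (mulPotential V φ) := by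
    intro ψ φ
    rw [lp.inner_eq_tsum, lp.inner_eq_tsum]
    refine tsum_congr fun n => ?_
    change inner ℂ ((V n : ℂ) * ψ n) (φ n) = inner ℂ (ψ n) ((V n : ℂ) * φ n)
    simp only [RCLike.inner_apply, map_mul, Complex.conj_ofReal]
    ring
  rw [ContinuousLinearMap.isSelfAdjoint_iff_isSymmetric]
  intro ψ φ
  change inner ℂ (translate (-1) ψ + translate 1 ψ + mulPotential V ψ) φ =
    inner ℂ ψ (translate (-1) φ + translate 1 φ + mulPotential V φ)
  simp only [inner_add_left, inner_add_right, ht, hm, neg_neg]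
  ring

/-! ### Spectral measures -/

/-- The positive functional `g ↦ ⟨φ, g(T) φ⟩` on `C_c(ℝ)`, with `g(T)` given by the continuous
functional calculus of the bounded self-adjoint operator `T`. -/
def spectralFunctional {E : Type*} [NormedAddCommGroup E] [InnerProductSpace ℂ E]
    [CompleteSpace E] (T : E →L[ℂ] E) (φ : E) : C_c(ℝ, ℝ) →ₚ[ℝ] ℝ :=
  PositiveLinearMap.mk₀
    { toFun := fun g => (inner ℂ φ (cfc (fun x => g x) T φ)).re
      map_add' := fun g h => by
        have e : cfc (fun x => (g + h) x) T = cfc (fun x => g x) T + cfc (fun x => h x) T :=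
          cfc_add T (fun x => g x) (fun x => h x)
        rw [e, add_apply, inner_add_right, Complex.add_re]
      map_smul' := fun c g => by
        have e : cfc (fun x => (c • g) x) T = c • cfc (fun x => g x) T :=
          cfc_smul c (fun x => g x) T
        rw [e, smul_apply, inner_smul_right_eq_smul]
        simp }
    (fun g hg => by
      have h : 0 ≤ cfc (fun x => g x) T := cfc_nonneg fun x _ => hg x
      rw [ContinuousLinearMap.nonneg_iff_isPositive] at h
      exact h.re_inner_nonneg_right φ)

/-- The spectral measure `μ_{φ,φ}` of the bounded self-adjoint operator `T` at the vector `φ`: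
the regular Borel measure on `ℝ` representing `g ↦ ⟨φ, g(T) φ⟩`. -/
def spectralMeasure {E : Type*} [NormedAddCommGroup E] [InnerProductSpace ℂ E]
    [CompleteSpace E] (T : E →L[ℂ] E) (φ : E) : Measure ℝ :=
  RealRMK.rieszMeasure (spectralFunctional T φ)

theorem integral_spectralMeasure {E : Type*} [NormedAddCommGroup E] [InnerProductSpace ℂ E]
    [CompleteSpace E] (T : E →L[ℂ] E) (φ : E) (g : C_c(ℝ, ℝ)) :
    ∫ x, g x ∂(spectralMeasure T φ) = (inner ℂ φ (cfc (fun x => g x) T φ)).re :=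
  RealRMK.integral_rieszMeasure (spectralFunctional T φ) g

/-! ### The quasiperiodic family -/

/-- The potential `n ↦ f(θ + nα)`. -/
def potential (f : C(UnitAddCircle, ℝ)) (α : ℝ) (θ : UnitAddCircle) : ℤ →ᵇ ℝ :=
  (BoundedContinuousFunction.mkOfCompact f).compContinuous
    ⟨fun n : ℤ => θ + ((n * α : ℝ) : UnitAddCircle), continuous_of_discreteTopology⟩

theorem potential_apply (f : C(UnitAddCircle, ℝ)) (α : ℝ) (θ : UnitAddCircle) (n : ℤ) :
    potential f α θ n = f (θ + ((n * α : ℝ) : UnitAddCircle)) := rfl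

/-- The operator `H_{α,θ}`. -/
def quasiperiodicOp (f : C(UnitAddCircle, ℝ)) (α : ℝ) (θ : UnitAddCircle) : L2Z →L[ℂ] L2Z :=
  schrodinger (potential f α θ)

/-- The set `σ_α = ⋃_θ σ(H_{α,θ})`; for irrational `α` every `σ(H_{α,θ})` is equal to it. -/
def spectrumSet (f : C(UnitAddCircle, ℝ)) (α : ℝ) : Set ℝ :=
  {E | ∃ θ : UnitAddCircle, (E : ℂ) ∈ spectrum ℂ (quasiperiodicOp f α θ)}

/-- The canonical spectral measure `μ_{α,θ} = μ_{δ₀,δ₀} + μ_{δ₁,δ₁}` of `H_{α,θ}`. -/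
def canonicalMeasure (f : C(UnitAddCircle, ℝ)) (α : ℝ) (θ : UnitAddCircle) : Measure ℝ :=
  spectralMeasure (quasiperiodicOp f α θ) (delta 0) +
    spectralMeasure (quasiperiodicOp f α θ) (delta 1)

/-! ### The Lyapunov exponent -/

/-- The one-step transfer matrix at energy `E` and potential value `v`. -/
def stepMatrix (E v : ℝ) : Matrix (Fin 2) (Fin 2) ℝ := !![E - v, -1; 1, 0]

/-- The `n`-step transfer matrix `T(n-1) ⋯ T(0)`. -/
def transferMatrix (f : C(UnitAddCircle, ℝ)) (α : ℝ) (θ : UnitAddCircle) (E : ℝ) :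
    ℕ → Matrix (Fin 2) (Fin 2) ℝ
  | 0 => 1
  | n + 1 => stepMatrix E (potential f α θ (n : ℤ)) * transferMatrix f α θ E n

/-- The Lyapunov exponent `γ(E) = lim (1/n) ∫ log ‖Φ_{α,θ,[0,n-1]}(E)‖ dθ`, with the Euclidean
operator norm and the normalised Haar measure of the circle. The limit exists in `ℝ` since the
integrals are nonnegative and subadditive in `n`. -/
def lyapunov (f : C(UnitAddCircle, ℝ)) (α : ℝ) (E : ℝ) : ℝ :=
  limUnder atTop fun n : ℕ => (1 / (n : ℝ)) *
    ∫ θ : UnitAddCircle,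
      Real.log ‖Matrix.toEuclideanCLM (𝕜 := ℝ) (transferMatrix f α θ E n)‖

/-! ### Floquet matrices -/

/-- The Floquet matrix of size `q` at `ϰ`: row and column `i` belong to the site
`i - ⌊(q-1)/2⌋ ∈ (-q/2, q/2]`; nearest neighbours are coupled by `1`, and the first and the last
site by `e^{iqϰ}` and its conjugate. For `q = 1, 2`, where these entries overlap, they add up. -/
def floquetMatrix (q : ℕ) (V : ℤ → ℝ) (ϰ : ℝ) : Matrix (Fin q) (Fin q) ℂ :=
  Matrix.of fun i j =>
    (if i = j then (V ((i : ℤ) - ((q - 1) / 2 : ℕ)) : ℂ) else 0) +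
    (if (i : ℕ) + 1 = j then 1 else 0) +
    (if (j : ℕ) + 1 = i then 1 else 0) +
    (if (i : ℕ) = 0 ∧ (j : ℕ) + 1 = q then Complex.exp (Complex.I * (q * ϰ)) else 0) +
    (if (j : ℕ) = 0 ∧ (i : ℕ) + 1 = q then Complex.exp (-(Complex.I * (q * ϰ))) else 0)

theorem floquetMatrix_isHermitian (q : ℕ) (V : ℤ → ℝ) (ϰ : ℝ) :
    (floquetMatrix q V ϰ).IsHermitian := by
  refine Matrix.IsHermitian.ext fun i j => ?_
  have e1 : (starRingEnd ℂ) (Complex.exp (Complex.I * (q * ϰ))) =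
      Complex.exp (-(Complex.I * (q * ϰ))) := by
    rw [← Complex.exp_conj]; simp
  have e2 : (starRingEnd ℂ) (Complex.exp (-(Complex.I * (q * ϰ)))) =
      Complex.exp (Complex.I * (q * ϰ)) := by
    rw [← e1, Complex.conj_conj]
  simp only [floquetMatrix, Matrix.of_apply, RCLike.star_def, map_add,
    apply_ite (starRingEnd ℂ), map_zero, map_one, Complex.conj_ofReal, e1, e2]
  by_cases h : i = j
  · subst h; simp; ring
  · rw [if_neg h, if_neg (Ne.symm h)]; ring

/-- The index in `Fin q` of the site `k` (modulo `q`), so that `e_k` is the corresponding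
canonical basis vector of `ℂ^q`. -/
def siteIndex (q : ℕ) [NeZero q] (k : ℕ) : Fin q := Fin.ofNat q (k + (q - 1) / 2)

/-- The canonical spectral measure `∑_j (|⟨Ψ_j, e_0⟩|² + |⟨Ψ_j, e_1⟩|²) δ_{λ_j}` of the Floquet
matrix, `(λ_j, Ψ_j)` being an orthonormal eigensystem. -/
def floquetMeasure (q : ℕ) [NeZero q] (V : ℤ → ℝ) (ϰ : ℝ) : Measure ℝ :=
  ∑ j : Fin q,
    ENNReal.ofReal
      (‖(floquetMatrix_isHermitian q V ϰ).eigenvectorBasis j (siteIndex q 0)‖ ^ 2 +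
        ‖(floquetMatrix_isHermitian q V ϰ).eigenvectorBasis j (siteIndex q 1)‖ ^ 2) •
      Measure.dirac ((floquetMatrix_isHermitian q V ϰ).eigenvalues j)

end QPS

end

namespace QPS

/-! ### Uniform equidistribution of irrational rotations -/

/-! The measures converge weakly, and the ball's two boundary points carry no mass in the limit.

Weak convergence: the `k`-th moment at site `s` depends only on the potential within distance `k` of
`s`. A Floquet matrix of large size therefore has the same low moments as the operator on `ℤ` with
the same potential, whatever `ϰ` is. The potentials converge pointwise as the frequency tends to `α`
and the phase to `θ`, and all supports lie in one compact interval, so Weierstrass approximation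
gives convergence against every `g` in `C_c` (`tendsto_integral_floquetMeasure`,
`tendsto_integral_canonicalMeasure`).

No atoms at `E₀ ± ε`: an atom of a spectral measure is an eigenvalue
(`exists_eigenvector_of_spectralMeasure_singleton`), and Gordon's argument excludes eigenvalues `E`
with `2γ(E) < β` (`eq_zero_of_schrodinger_solution`). Transfer matrices of length `n` are at most `C
e^{nc}` uniformly in the phase, with `γ(E) < c < β/2`. Shifting the phase by `q_m α` changes `f` by
at most `K q_m e^{-β q_m}`. Consecutive blocks of length `q_m` thus agree so closely that a decaying
solution would be contracted by `A`, `A²` and `A⁻¹` together, against Cayley–Hamilton. Continuity of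
`γ` carries the bound `2γ < β` to the endpoints.

The convergence holds jointly in `(m, θ)` with `ϰ` arbitrary, so compactness of the circle makes it
uniform. -/

theorem fourier_irrational_ne_one {a : ℝ} (ha : Irrational a) {j : ℤ} (hj : j ≠ 0) :
    fourier j (a : UnitAddCircle) ≠ 1 := by
  intro h
  rw [fourier_coe_apply, Complex.exp_eq_one_iff] at h
  obtain ⟨n, hn⟩ := h
  have hp : (2 * Real.pi * Complex.I : ℂ) ≠ 0 := Complex.two_pi_I_ne_zero
  have h1 : (j * a : ℂ) = n := by
    apply mul_left_cancel₀ hp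
    rw [mul_comm _ (n : ℂ), ← hn]
    push_cast; ring
  have h2 : (j : ℝ) * a = n := by exact_mod_cast h1
  exact (ha.intCast_mul hj).ne_int n h2

theorem fourier_add_eq_mul (j : ℤ) (x y : UnitAddCircle) :
    fourier j (x + y) = fourier j x * fourier j y := by
  simp [fourier_apply, smul_add, AddCircle.toCircle_add]

/-- A nontrivial character turns the sum into a geometric series with ratio different from `1`, so
the bound depends on neither `n` nor `θ`. -/
theorem norm_birkhoff_fourier_le {a : ℝ} (ha : Irrational a) {j : ℤ} (hj : j ≠ 0) (n : ℕ)
    (θ : UnitAddCircle) :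
    ‖∑ k ∈ Finset.range n, fourier j (θ + k • (a : UnitAddCircle))‖ ≤
      2 / ‖fourier j (a : UnitAddCircle) - 1‖ := by
  have hz := fourier_irrational_ne_one ha hj
  have hpow : ∀ k : ℕ, fourier j (k • (a : UnitAddCircle)) = fourier j (a : UnitAddCircle) ^ k := by
    intro k
    induction k with
    | zero => simp
    | succ k ih => rw [succ_nsmul, fourier_add_eq_mul, ih, pow_succ]
  have hn : ∀ x : UnitAddCircle, ‖fourier j x‖ = 1 := fun x => by
    rw [fourier_apply]; exact Circle.norm_coe _
  simp_rw [fourier_add_eq_mul, ← Finset.mul_sum, hpow]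
  rw [geom_sum_eq hz, norm_mul, hn, one_mul, norm_div]
  gcongr
  refine (norm_sub_le _ _).trans ?_
  rw [norm_pow, hn, one_pow, norm_one]
  norm_num

/-- Translation by `√2`, or by any other irrational, preserves the integral and multiplies it by a
factor other than `1`. -/
theorem integral_fourier_eq_zero {j : ℤ} (hj : j ≠ 0) :
    ∫ x : UnitAddCircle, fourier j x = 0 := by
  have hz := fourier_irrational_ne_one irrational_sqrt_two hj
  set a : UnitAddCircle := ((√2 : ℝ) : UnitAddCircle)
  have h := integral_add_right_eq_self (μ := (volume : Measure UnitAddCircle))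
    (fun x => fourier j x) a
  simp_rw [fourier_add_eq_mul, integral_mul_const] at h
  have h' : (∫ x : UnitAddCircle, fourier j x) * (fourier j a - 1) = 0 := by
    rw [mul_sub, h, mul_one, sub_self]
  exact (mul_eq_zero.1 h').resolve_right (sub_ne_zero.2 hz)

/-- The Birkhoff averages of a continuous function along an irrational rotation converge
uniformly to its mean. -/
theorem eventually_birkhoff_sub_integral_le {a : ℝ} (ha : Irrational a) (g : C(UnitAddCircle, ℂ))
    {ε : ℝ} (hε : 0 < ε) :
    ∀ᶠ n : ℕ in atTop, ∀ θ : UnitAddCircle,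
      ‖∑ k ∈ Finset.range n, g (θ + k • (a : UnitAddCircle)) - n * ∫ x, g x‖ ≤ n * ε := by
  have hint : ∀ g : C(UnitAddCircle, ℂ), Integrable g := fun g =>
    g.continuous.integrable_of_hasCompactSupport (HasCompactSupport.of_compactSpace _)
  have hv : (volume : Measure UnitAddCircle).real univ = 1 := by
    simp [Measure.real]
  -- On trigonometric polynomials the deviation stays bounded in `n`, a property stable under linear
  -- combinations.
  have hspan : ∀ g ∈ Submodule.span ℂ (range (@fourier (1 : ℝ))), ∃ C : ℝ, ∀ (n : ℕ) θ,
      ‖∑ k ∈ Finset.range n, g (θ + k • (a : UnitAddCircle)) - n * ∫ x, g x‖ ≤ C := by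
    intro g hg
    induction hg using Submodule.span_induction with
    | mem x hx =>
      obtain ⟨j, rfl⟩ := hx
      by_cases hj : j = 0
      · subst hj
        refine ⟨0, fun n θ => ?_⟩
        simp only [fourier_zero, Finset.sum_const, Finset.card_range, nsmul_eq_mul, mul_one,
          integral_const, hv, one_smul, sub_self, norm_zero, le_refl]
      · refine ⟨2 / ‖fourier j (a : UnitAddCircle) - 1‖, fun n θ => ?_⟩
        rw [integral_fourier_eq_zero hj, mul_zero, sub_zero]
        exact norm_birkhoff_fourier_le ha hj n θ
    | zero => exact ⟨0, fun n θ => by simp⟩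
    | add g h _ _ hg hh =>
      obtain ⟨C, hC⟩ := hg
      obtain ⟨D, hD⟩ := hh
      refine ⟨C + D, fun n θ => ?_⟩
      simp only [ContinuousMap.add_apply]
      rw [Finset.sum_add_distrib, integral_add (hint g) (hint h), mul_add, add_sub_add_comm]
      exact (norm_add_le _ _).trans (add_le_add (hC n θ) (hD n θ))
    | smul c g _ hg =>
      obtain ⟨C, hC⟩ := hg
      refine ⟨‖c‖ * C, fun n θ => ?_⟩
      simp only [ContinuousMap.smul_apply, smul_eq_mul]
      rw [← Finset.mul_sum, integral_const_mul, mul_left_comm, ← mul_sub, norm_mul]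
      gcongr
      exact hC n θ
  have hmem : g ∈ closure (Submodule.span ℂ (range (@fourier (1 : ℝ))) :
      Set C(UnitAddCircle, ℂ)) := by
    rw [← Submodule.topologicalClosure_coe, span_fourier_closure_eq_top]
    trivial
  -- Replacing `g` by `h` costs `ε / 4` in the average and `ε / 4` in the mean, which leaves `ε / 2`
  -- for `C / n`.
  obtain ⟨h, hh, hgh⟩ := Metric.mem_closure_iff.1 hmem (ε / 4) (by positivity)
  obtain ⟨C, hC⟩ := hspan h hh
  have hd : ∀ x, ‖g x - h x‖ ≤ ε / 4 := fun x => by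
    rw [← dist_eq_norm]; exact (ContinuousMap.dist_apply_le_dist x).trans hgh.le
  have hi : ‖(∫ x, g x) - ∫ x, h x‖ ≤ ε / 4 := by
    rw [← integral_sub (hint g) (hint h)]
    refine (norm_integral_le_of_norm_le_const (Eventually.of_forall hd)).trans ?_
    rw [hv, mul_one]
  filter_upwards [eventually_ge_atTop (Nat.ceil (C / (ε / 2)))] with n hn θ
  have hn' : C ≤ n * (ε / 2) := by
    rw [← div_le_iff₀ (by positivity)]
    exact (Nat.le_ceil _).trans (by exact_mod_cast hn)
  have e : ∑ k ∈ Finset.range n, g (θ + k • (a : UnitAddCircle)) - n * ∫ x, g x =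
      ∑ k ∈ Finset.range n, (g (θ + k • (a : UnitAddCircle)) - h (θ + k • (a : UnitAddCircle))) +
      (∑ k ∈ Finset.range n, h (θ + k • (a : UnitAddCircle)) - n * ∫ x, h x) -
      n * ((∫ x, g x) - ∫ x, h x) := by
    rw [Finset.sum_sub_distrib]; ring
  rw [e]
  refine (norm_sub_le _ _).trans ?_
  have h1 : ‖∑ k ∈ Finset.range n,
      (g (θ + k • (a : UnitAddCircle)) - h (θ + k • (a : UnitAddCircle)))‖ ≤ n * (ε / 4) := by
    refine (norm_sum_le_of_le _ fun k _ => hd _).trans ?_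
    simp
  have h3 : ‖(n : ℂ) * ((∫ x, g x) - ∫ x, h x)‖ ≤ n * (ε / 4) := by
    rw [norm_mul, Complex.norm_natCast]
    gcongr
  have h2 := norm_add_le (∑ k ∈ Finset.range n,
    (g (θ + k • (a : UnitAddCircle)) - h (θ + k • (a : UnitAddCircle))))
    (∑ k ∈ Finset.range n, h (θ + k • (a : UnitAddCircle)) - n * ∫ x, h x)
  have := hC n θ
  linarith

theorem eventually_birkhoff_le {a : ℝ} (ha : Irrational a) (g : C(UnitAddCircle, ℝ))
    {c : ℝ} (hc : ∫ x, g x < c) :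
    ∀ᶠ n : ℕ in atTop, ∀ θ : UnitAddCircle,
      ∑ k ∈ Finset.range n, g (θ + k • (a : UnitAddCircle)) ≤ n * c := by
  let G : C(UnitAddCircle, ℂ) := ⟨fun x => (g x : ℂ), by fun_prop⟩
  filter_upwards [eventually_birkhoff_sub_integral_le ha G (sub_pos.2 hc)] with n hn θ
  have h := hn θ
  have e : ∑ k ∈ Finset.range n, G (θ + k • (a : UnitAddCircle)) - n * ∫ x, G x =
      ((∑ k ∈ Finset.range n, g (θ + k • (a : UnitAddCircle)) - n * ∫ x, g x : ℝ) : ℂ) := by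
    simp only [G, ContinuousMap.coe_mk, integral_complex_ofReal]
    push_cast; ring
  rw [e, Complex.norm_real] at h
  have := (le_abs_self _).trans h
  linarith

end QPS
namespace QPS

section Transfer

open scoped Matrix.Norms.L2Operator

/-! ### Transfer matrices and the Lyapunov exponent -/

/-- The adjugate of a 2×2 matrix is its transpose conjugated by a quarter turn `J`, an isometry.
Inverses of transfer matrices thus obey the same bounds as the matrices. -/
theorem norm_adjugate_le (M : Matrix (Fin 2) (Fin 2) ℝ) : ‖M.adjugate‖ ≤ ‖M‖ := by
  set J : Matrix (Fin 2) (Fin 2) ℝ := !![0, 1; -1, 0]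
  have hJJ : J.conjTranspose * J = 1 := by
    ext i j; fin_cases i <;> fin_cases j <;> simp [J, Matrix.mul_apply, Fin.sum_univ_two]
  have hJ : ‖J‖ = 1 := by
    have h := Matrix.l2_opNorm_conjTranspose_mul_self J
    rw [hJJ, norm_one] at h
    nlinarith [norm_nonneg J]
  have e : M.adjugate = J * M.conjTranspose * J.conjTranspose := by
    rw [Matrix.adjugate_fin_two]
    ext i j; fin_cases i <;> fin_cases j <;>
      simp [J, Matrix.mul_apply, Matrix.vecMul, dotProduct, Fin.sum_univ_two]
  rw [e]
  refine (norm_mul_le _ _).trans ?_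
  rw [Matrix.l2_opNorm_conjTranspose, hJ, mul_one]
  refine (norm_mul_le _ _).trans ?_
  rw [Matrix.l2_opNorm_conjTranspose, hJ, one_mul]

theorem one_le_norm_of_det_eq_one {M : Matrix (Fin 2) (Fin 2) ℝ} (h : M.det = 1) : 1 ≤ ‖M‖ := by
  have h1 : (1 : Matrix (Fin 2) (Fin 2) ℝ) = M.adjugate * M := by
    rw [Matrix.adjugate_mul, h, one_smul]
  have h2 : (1 : ℝ) ≤ ‖M‖ * ‖M‖ := by
    calc (1 : ℝ) = ‖M.adjugate * M‖ := by rw [← h1, norm_one]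
      _ ≤ ‖M.adjugate‖ * ‖M‖ := norm_mul_le _ _
      _ ≤ ‖M‖ * ‖M‖ := by gcongr; exact norm_adjugate_le M
  nlinarith [norm_nonneg M]

theorem norm_stepMatrix_sub_le (E v w : ℝ) : ‖stepMatrix E v - stepMatrix E w‖ ≤ |v - w| := by
  have e : stepMatrix E v - stepMatrix E w = Matrix.diagonal ![w - v, 0] := by
    ext i j; fin_cases i <;> fin_cases j <;> simp [stepMatrix]
  rw [e, Matrix.l2_opNorm_diagonal, pi_norm_le_iff_of_nonneg (abs_nonneg _)]
  intro i
  fin_cases i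
  · simp [abs_sub_comm]
  · simp

theorem det_transferMatrix (f : C(UnitAddCircle, ℝ)) (α : ℝ) (θ : UnitAddCircle) (E : ℝ) (n : ℕ) :
    (transferMatrix f α θ E n).det = 1 := by
  induction n with
  | zero => simp [transferMatrix]
  | succ n ih => rw [transferMatrix, Matrix.det_mul, ih]; simp [stepMatrix, Matrix.det_fin_two]

theorem potential_natCast (f : C(UnitAddCircle, ℝ)) (α : ℝ) (θ : UnitAddCircle) (n : ℕ) :
    potential f α θ (n : ℤ) = f (θ + n • (α : UnitAddCircle)) := by
  rw [potential_apply, ← AddCircle.coe_nsmul, nsmul_eq_mul, Int.cast_natCast]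

theorem transferMatrix_add (f : C(UnitAddCircle, ℝ)) (α : ℝ) (θ : UnitAddCircle) (E : ℝ)
    (n m : ℕ) :
    transferMatrix f α θ E (n + m) =
      transferMatrix f α (θ + n • (α : UnitAddCircle)) E m * transferMatrix f α θ E n := by
  induction m with
  | zero => simp [transferMatrix]
  | succ m ih =>
    rw [← add_assoc, transferMatrix, transferMatrix, ih, potential_natCast, potential_natCast,
      add_smul, add_assoc, mul_assoc]

theorem continuous_transferMatrix (f : C(UnitAddCircle, ℝ)) (α : ℝ) (E : ℝ) (n : ℕ) :
    Continuous fun θ => transferMatrix f α θ E n := by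
  induction n with
  | zero => exact continuous_const
  | succ n ih =>
    simp only [transferMatrix, potential_natCast]
    refine Continuous.mul ?_ ih
    unfold stepMatrix
    refine continuous_matrix fun i j => ?_
    fin_cases i <;> fin_cases j <;> simp <;> fun_prop

/-- The continuous function `θ ↦ log ‖T_n(θ)‖`. -/
noncomputable def logNorm (f : C(UnitAddCircle, ℝ)) (α : ℝ) (E : ℝ) (n : ℕ) : C(UnitAddCircle, ℝ) :=
  ⟨fun θ => Real.log ‖transferMatrix f α θ E n‖,
    (continuous_transferMatrix f α E n).norm.log fun θ =>
      (zero_lt_one.trans_le (one_le_norm_of_det_eq_one (det_transferMatrix f α θ E n))).ne'⟩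

theorem logNorm_nonneg (f : C(UnitAddCircle, ℝ)) (α : ℝ) (E : ℝ) (n : ℕ) (θ : UnitAddCircle) :
    0 ≤ logNorm f α E n θ :=
  Real.log_nonneg (one_le_norm_of_det_eq_one (det_transferMatrix f α θ E n))

theorem norm_transferMatrix_eq_exp (f : C(UnitAddCircle, ℝ)) (α : ℝ) (E : ℝ) (n : ℕ)
    (θ : UnitAddCircle) : ‖transferMatrix f α θ E n‖ = Real.exp (logNorm f α E n θ) :=
  (Real.exp_log
    (zero_lt_one.trans_le (one_le_norm_of_det_eq_one (det_transferMatrix f α θ E n)))).symm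

theorem logNorm_add_le (f : C(UnitAddCircle, ℝ)) (α : ℝ) (E : ℝ) (n m : ℕ) (θ : UnitAddCircle) :
    logNorm f α E (n + m) θ ≤
      logNorm f α E n θ + logNorm f α E m (θ + n • (α : UnitAddCircle)) := by
  rw [← Real.exp_le_exp, Real.exp_add, ← norm_transferMatrix_eq_exp, ← norm_transferMatrix_eq_exp,
    ← norm_transferMatrix_eq_exp, transferMatrix_add, mul_comm]
  exact norm_mul_le _ _

theorem integrable_logNorm (f : C(UnitAddCircle, ℝ)) (α : ℝ) (E : ℝ) (n : ℕ) :
    Integrable (logNorm f α E n) :=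
  (logNorm f α E n).continuous.integrable_of_hasCompactSupport (HasCompactSupport.of_compactSpace _)

theorem subadditive_integral_logNorm (f : C(UnitAddCircle, ℝ)) (α : ℝ) (E : ℝ) :
    Subadditive fun n => ∫ θ, logNorm f α E n θ := by
  intro n m
  have h := integral_add_right_eq_self (μ := (volume : Measure UnitAddCircle))
    (fun x => logNorm f α E m x) (n • (α : UnitAddCircle))
  dsimp only
  rw [← h, ← integral_add (integrable_logNorm f α E n)]
  · exact integral_mono (integrable_logNorm f α E _)
      ((integrable_logNorm f α E n).add ((integrable_logNorm f α E m).comp_add_right _))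
      fun θ => logNorm_add_le f α E n m θ
  · exact (integrable_logNorm f α E m).comp_add_right _

/-- Fekete's lemma: the `limUnder` in `lyapunov` is a genuine limit. -/
theorem tendsto_lyapunov (f : C(UnitAddCircle, ℝ)) (α : ℝ) (E : ℝ) :
    Tendsto (fun n : ℕ => (∫ θ, logNorm f α E n θ) / n) atTop (𝓝 (lyapunov f α E)) := by
  have h := (subadditive_integral_logNorm f α E).tendsto_lim
    ⟨0, by rintro _ ⟨n, rfl⟩
           exact div_nonneg (integral_nonneg fun θ => logNorm_nonneg f α E n θ) n.cast_nonneg⟩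
  have e : (fun n : ℕ => (∫ θ, logNorm f α E n θ) / n) = fun n : ℕ => (1 / (n : ℝ)) *
      ∫ θ : UnitAddCircle,
        Real.log ‖Matrix.toEuclideanCLM (𝕜 := ℝ) (transferMatrix f α θ E n)‖ := by
    funext n
    rw [div_eq_inv_mul, ← one_div]
    rfl
  rw [e] at h ⊢
  exact tendsto_nhds_limUnder ⟨_, h⟩

theorem lyapunov_nonneg (f : C(UnitAddCircle, ℝ)) (α : ℝ) (E : ℝ) : 0 ≤ lyapunov f α E :=
  ge_of_tendsto' (tendsto_lyapunov f α E) fun n =>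
    div_nonneg (integral_nonneg fun θ => logNorm_nonneg f α E n θ) n.cast_nonneg

/-- Cutting the orbit into blocks of length `M` bounds the cocycle by a Birkhoff sum for the
rotation by `Mα`, which is again irrational when `M ≠ 0`. -/
theorem logNorm_mul_le (f : C(UnitAddCircle, ℝ)) (α : ℝ) (E : ℝ) (M n : ℕ) (θ : UnitAddCircle) :
    logNorm f α E (n * M) θ ≤
      ∑ k ∈ Finset.range n, logNorm f α E M (θ + k • (((M * α : ℝ)) : UnitAddCircle)) := by
  induction n with
  | zero => simp [logNorm, transferMatrix]
  | succ n ih =>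
    rw [Finset.sum_range_succ, add_mul, one_mul]
    refine (logNorm_add_le f α E _ _ θ).trans (add_le_add ih (le_of_eq ?_))
    congr 2
    rw [mul_smul]
    congr 1
    rw [← nsmul_eq_mul, AddCircle.coe_nsmul]

/-- Uniform upper bound for the transfer matrices: they grow at most at any rate exceeding the
Lyapunov exponent, uniformly in the phase. -/
theorem exists_norm_transferMatrix_le (f : C(UnitAddCircle, ℝ)) {α : ℝ} (hα : Irrational α)
    {E c : ℝ} (hc : lyapunov f α E < c) :
    ∃ C : ℝ, 0 < C ∧ ∀ (n : ℕ) (θ : UnitAddCircle),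
      ‖transferMatrix f α θ E n‖ ≤ C * Real.exp (n * c) := by
  have hc0 : 0 < c := (lyapunov_nonneg f α E).trans_lt hc
  obtain ⟨M, hM, hM0⟩ := (((tendsto_lyapunov f α E).eventually_lt_const hc).and
    (eventually_gt_atTop 0)).exists
  have hM' : (0 : ℝ) < M := by exact_mod_cast hM0
  rw [div_lt_iff₀ hM'] at hM
  -- Uniform equidistribution turns the mean bound at length `M` into a bound valid at every phase,
  -- at the single length `N = j * M`.
  obtain ⟨j, hj, hj0⟩ := ((eventually_birkhoff_le (hα.natCast_mul hM0.ne') _ hM).and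
    (eventually_gt_atTop 0)).exists
  set N := j * M
  have hN : 0 < N := Nat.mul_pos hj0 hM0
  have hNb : ∀ θ, logNorm f α E N θ ≤ N * c := fun θ => by
    refine ((logNorm_mul_le f α E M j θ).trans (hj θ)).trans (le_of_eq ?_)
    simp only [N]; push_cast; ring
  have hkN : ∀ (k : ℕ) θ, logNorm f α E (k * N) θ ≤ (k * N : ℕ) * c := by
    intro k θ
    refine (logNorm_mul_le f α E N k θ).trans ?_
    refine (Finset.sum_le_sum fun i _ => hNb _).trans (le_of_eq ?_)
    simp; ring
  -- The remainder `n % N` takes finitely many values, and each `logNorm` is bounded on the circle;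
  -- this gives the constant `D'`.
  have hb : ∀ r : ℕ, ∃ D, ∀ θ, logNorm f α E r θ ≤ D := fun r =>
    ⟨‖logNorm f α E r‖, fun θ => (le_abs_self _).trans ((logNorm f α E r).norm_coe_le_norm θ)⟩
  choose D hD using hb
  obtain ⟨D', hD'⟩ := ((Finset.range N).image D).exists_le
  refine ⟨Real.exp D', Real.exp_pos _, fun n θ => ?_⟩
  rw [norm_transferMatrix_eq_exp, ← Real.exp_add, Real.exp_le_exp]
  have e : n / N * N + n % N = n := Nat.div_add_mod' n N
  have h1 := logNorm_add_le f α E (n / N * N) (n % N) θ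
  rw [e] at h1
  have h2 := hkN (n / N) θ
  have h3 := (hD (n % N) (θ + (n / N * N) • (α : UnitAddCircle))).trans
    (hD' _ (Finset.mem_image_of_mem D <| Finset.mem_range.2 (Nat.mod_lt _ hN)))
  have h4 : ((n / N * N : ℕ) : ℝ) * c ≤ n * c := by
    gcongr
    exact Nat.div_mul_le_self n N
  linarith

end Transfer

end QPS
namespace QPS

section Gordon

open scoped Matrix.Norms.L2Operator

/-! ### Absence of eigenvalues for well approximable frequencies -/

theorem norm_transferMatrix_sub_le (f : C(UnitAddCircle, ℝ)) (α E c C : ℝ) (hc : 0 ≤ c)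
    (hC : 0 < C) (hT : ∀ (n : ℕ) (θ : UnitAddCircle),
      ‖transferMatrix f α θ E n‖ ≤ C * Real.exp (n * c))
    {s : UnitAddCircle} {η : ℝ} (hη : ∀ x, |f (x + s) - f x| ≤ η) (θ : UnitAddCircle) (n : ℕ) :
    ‖transferMatrix f α (θ + s) E n - transferMatrix f α θ E n‖ ≤
      n * η * C ^ 2 * Real.exp (n * c) := by
  have hη0 : 0 ≤ η := (abs_nonneg _).trans (hη 0)
  -- Telescoping, one factor changed at a time. The extra `m` steps on the left let each product
  -- beyond the changed factor be estimated as one transfer matrix, so the constant is `C ^ 2` and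
  -- does not grow with `n`.
  have key : ∀ n m : ℕ, ‖transferMatrix f α (θ + s + n • (α : UnitAddCircle)) E m *
      (transferMatrix f α (θ + s) E n - transferMatrix f α θ E n)‖ ≤
        n * η * C ^ 2 * Real.exp ((n + m : ℕ) * c) := by
    intro n
    induction n with
    | zero => intro m; simp [transferMatrix]
    | succ n ih =>
      intro m
      set x := θ + s + n • (α : UnitAddCircle)
      set y := θ + n • (α : UnitAddCircle)
      have hx : x = y + s := by simp only [x, y]; abel
      have hx1 : θ + s + (n + 1) • (α : UnitAddCircle) = x + 1 • (α : UnitAddCircle) := by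
        simp only [x, add_smul]; abel
      have e1 : transferMatrix f α (x + 1 • (α : UnitAddCircle)) E m * stepMatrix E (f x) =
          transferMatrix f α x E (m + 1) := by
        rw [add_comm m 1, transferMatrix_add]
        congr 1
        simp [transferMatrix, potential_apply]
      have e : transferMatrix f α (x + 1 • (α : UnitAddCircle)) E m *
          (transferMatrix f α (θ + s) E (n + 1) - transferMatrix f α θ E (n + 1)) =
          transferMatrix f α x E (m + 1) *
            (transferMatrix f α (θ + s) E n - transferMatrix f α θ E n) +
          transferMatrix f α (x + 1 • (α : UnitAddCircle)) E m *
            (stepMatrix E (f x) - stepMatrix E (f y)) * transferMatrix f α θ E n := by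
        rw [← e1, transferMatrix, transferMatrix, potential_natCast, potential_natCast]
        noncomm_ring
      rw [hx1, e]
      refine (norm_add_le _ _).trans ?_
      have h1 := ih (m + 1)
      have h2 : ‖transferMatrix f α (x + 1 • (α : UnitAddCircle)) E m *
            (stepMatrix E (f x) - stepMatrix E (f y)) * transferMatrix f α θ E n‖ ≤
          (C * Real.exp (m * c)) * η * (C * Real.exp (n * c)) := by
        refine (norm_mul_le _ _).trans ?_
        gcongr
        · refine (norm_mul_le _ _).trans ?_
          gcongr
          · exact hT _ _
          · refine (norm_stepMatrix_sub_le _ _ _).trans ?_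
            rw [hx]; exact hη y
        · exact hT _ _
      have h3 : (C * Real.exp (m * c)) * η * (C * Real.exp (n * c)) ≤
          η * C ^ 2 * Real.exp ((n + 1 + m : ℕ) * c) := by
        have : Real.exp (m * c) * Real.exp (n * c) ≤ Real.exp ((n + 1 + m : ℕ) * c) := by
          rw [← Real.exp_add, Real.exp_le_exp]
          push_cast
          nlinarith
        calc _ = η * C ^ 2 * (Real.exp (m * c) * Real.exp (n * c)) := by ring
          _ ≤ _ := by gcongr
      rw [show n + (m + 1) = n + 1 + m by ring] at h1
      push_cast at h1 h3 ⊢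
      linarith
  have h := key n 0
  rwa [transferMatrix, one_mul, add_zero] at h

/-- Gordon's argument: a vector cannot be contracted at the same time by `A`, `A²` and `A⁻¹`. -/
theorem eq_zero_of_tendsto_mulVec {A : ℕ → Matrix (Fin 2) (Fin 2) ℝ} (hA : ∀ m, (A m).det = 1)
    {U : Fin 2 → ℝ} (h1 : Tendsto (fun m => Matrix.mulVec (A m) U) atTop (𝓝 0))
    (h2 : Tendsto (fun m => Matrix.mulVec (A m) (Matrix.mulVec (A m) U)) atTop (𝓝 0))
    (h3 : Tendsto (fun m => Matrix.mulVec (A m).adjugate U) atTop (𝓝 0)) : U = 0 := by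
  -- Cayley–Hamilton with determinant `1`: `A + A⁻¹ = tr A` and `A² = (tr A) A - 1`. If `U ≠ 0`, the
  -- first forces `tr A → 0`, and then the second forces `A² U → -U`.
  have e1 : ∀ m, Matrix.mulVec (A m) U + Matrix.mulVec (A m).adjugate U = (A m).trace • U := by
    intro m
    rw [Matrix.adjugate_fin_two]
    ext i; fin_cases i <;>
      simp [dotProduct, Fin.sum_univ_two, Matrix.trace_fin_two] <;> ring
  have e2 : ∀ m, Matrix.mulVec (A m) (Matrix.mulVec (A m) U) =
      (A m).trace • Matrix.mulVec (A m) U - U := by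
    intro m
    have hd := hA m
    rw [Matrix.det_fin_two] at hd
    ext i; fin_cases i
    · simp [Matrix.mulVec, dotProduct, Fin.sum_univ_two, Matrix.trace_fin_two]
      linear_combination (-U 0) * hd
    · simp [Matrix.mulVec, dotProduct, Fin.sum_univ_two, Matrix.trace_fin_two]
      linear_combination (-U 1) * hd
  by_contra hU
  obtain ⟨i, hi⟩ := Function.ne_iff.1 hU
  have ht : Tendsto (fun m => (A m).trace • U) atTop (𝓝 0) := by
    simpa only [e1, add_zero] using h1.add h3
  have ht' : Tendsto (fun m => (A m).trace) atTop (𝓝 0) := by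
    have h := ((tendsto_pi_nhds.1 ht) i).mul_const (U i)⁻¹
    simpa [mul_assoc, mul_inv_cancel₀ hi] using h
  have h4 : Tendsto (fun m => (A m).trace • Matrix.mulVec (A m) U - U) atTop (𝓝 (-U)) := by
    simpa using (ht'.smul h1).sub_const U
  simp_rw [← e2] at h4
  exact hU (neg_eq_zero.1 (tendsto_nhds_unique h4 h2))

/-- The vector `(u(n), u(n-1))`. -/
def statePair (u : ℤ → ℝ) (n : ℤ) : Fin 2 → ℝ := ![u n, u (n - 1)]

theorem transferMatrix_mulVec_statePair {f : C(UnitAddCircle, ℝ)} {α E : ℝ} {θ : UnitAddCircle}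
    {u : ℤ → ℝ} (hu : ∀ n, u (n - 1) + u (n + 1) + potential f α θ n * u n = E * u n)
    (a : ℤ) (n : ℕ) :
    Matrix.mulVec (transferMatrix f α (θ + a • (α : UnitAddCircle)) E n) (statePair u a) =
      statePair u (a + n) := by
  induction n with
  | zero => simp [transferMatrix]
  | succ n ih =>
    rw [transferMatrix, ← Matrix.mulVec_mulVec, ih]
    have hp : potential f α (θ + a • (α : UnitAddCircle)) (n : ℤ) =
        potential f α θ (a + n) := by
      rw [potential_apply, potential_apply, ← AddCircle.coe_zsmul, add_assoc, ← AddCircle.coe_add,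
        zsmul_eq_mul]
      congr 3
      push_cast; ring
    have h := hu (a + n)
    rw [hp]
    ext i; fin_cases i
    · simp only [stepMatrix, statePair, Matrix.mulVec, dotProduct, Fin.sum_univ_two]
      simp [← add_assoc]
      linarith
    · simp [stepMatrix, statePair, Matrix.mulVec, dotProduct, Fin.sum_univ_two, ← add_assoc]

/-- Since `p` is an integer, the shift by `qα` equals the shift by `q(α - p/q)` on the circle. -/
theorem abs_sub_le_of_approx {f : C(UnitAddCircle, ℝ)} {K : ℝ≥0} (hf : LipschitzWith K f)
    {α δ : ℝ} {p : ℤ} {q : ℕ} (hq : 0 < q) (h : |α - (p : ℝ) / q| ≤ δ) (x : UnitAddCircle) :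
    |f (x + q • (α : UnitAddCircle)) - f x| ≤ K * (q * δ) := by
  have hq' : (0 : ℝ) < q := by exact_mod_cast hq
  have h1 := hf.dist_le_mul (x + q • (α : UnitAddCircle)) x
  rw [Real.dist_eq, dist_eq_norm, add_sub_cancel_left] at h1
  refine h1.trans ?_
  gcongr
  have e : q • (α : UnitAddCircle) = ((q * (α - (p : ℝ) / q) : ℝ) : UnitAddCircle) := by
    rw [mul_sub, mul_div_cancel₀ _ hq'.ne', AddCircle.coe_sub, ← AddCircle.coe_nsmul,
      nsmul_eq_mul]
    have : ((p : ℝ) : UnitAddCircle) = 0 := by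
      rw [AddCircle.coe_eq_zero_iff]; exact ⟨p, by simp⟩
    rw [this, sub_zero]
  rw [e]
  refine QuotientAddGroup.norm_mk_le_norm.trans ?_
  rw [Real.norm_eq_abs, abs_mul, abs_of_pos hq']
  gcongr

/-- If the rationals `p_m / q_m` approximate `α` at a rate `β > 2γ(E)`, then `E` is not an
eigenvalue of any of the operators `H_{α,θ}`. -/
theorem eq_zero_of_schrodinger_solution {f : C(UnitAddCircle, ℝ)} {K : ℝ≥0}
    (hf : LipschitzWith K f) {α : ℝ} (hα : Irrational α) {E β : ℝ} (hβ : 2 * lyapunov f α E < β)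
    {p : ℕ → ℤ} {q : ℕ → ℕ} (hq : Tendsto q atTop atTop)
    (happrox : ∀ m, |α - (p m : ℝ) / (q m : ℝ)| < Real.exp (-β * (q m : ℝ)))
    (θ : UnitAddCircle) {u : ℤ → ℝ}
    (hu : ∀ n, u (n - 1) + u (n + 1) + potential f α θ n * u n = E * u n)
    (h0 : Tendsto u cofinite (𝓝 0)) : u = 0 := by
  obtain ⟨c, hc1, hc2⟩ := exists_between (show lyapunov f α E < β / 2 by linarith)
  have hc0 : 0 ≤ c := (lyapunov_nonneg f α E).trans hc1.le
  obtain ⟨C, hC, hT⟩ := exists_norm_transferMatrix_le f hα hc1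
  have hδ : Tendsto (fun m => K * C ^ 2 * ((q m : ℝ) ^ 2 * Real.exp (-(β - 2 * c) * q m)))
      atTop (𝓝 0) := by
    have hb : 0 < β - 2 * c := by linarith
    have h := (Real.tendsto_pow_mul_exp_neg_atTop_nhds_zero 2).comp
      ((tendsto_natCast_atTop_atTop.comp hq).const_mul_atTop hb)
    have h' := h.const_mul (K * C ^ 2 * ((β - 2 * c) ^ 2)⁻¹ : ℝ)
    rw [mul_zero] at h'
    refine h'.congr fun m => ?_
    simp only [Function.comp_apply, neg_mul]
    field_simp
  -- The factor `exp (-(q m * c))` is split off to absorb one further transfer matrix of norm at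
  -- most `C * exp (q m * c)`; what remains still tends to `0` because `2c < β`.
  have hdiff : ∀ᶠ m in atTop, ∀ x : UnitAddCircle,
      ‖transferMatrix f α (x + q m • (α : UnitAddCircle)) E (q m) -
        transferMatrix f α x E (q m)‖ ≤
        K * C ^ 2 * ((q m : ℝ) ^ 2 * Real.exp (-(β - 2 * c) * q m)) *
          Real.exp (-(q m * c)) := by
    filter_upwards [hq.eventually_gt_atTop 0] with m hm x
    refine (norm_transferMatrix_sub_le f α E c C hc0 hC hT
      (abs_sub_le_of_approx hf hm (happrox m).le) x (q m)).trans (le_of_eq ?_)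
    have : Real.exp (-β * q m) * Real.exp (q m * c) =
        Real.exp (-(β - 2 * c) * q m) * Real.exp (-(q m * c)) := by
      rw [← Real.exp_add, ← Real.exp_add]; congr 1; ring
    linear_combination (K * C ^ 2 * (q m : ℝ) ^ 2) * this
  have hstate : ∀ g : ℕ → ℤ, Tendsto g atTop cofinite → ∀ b : ℤ,
      Tendsto (fun m => u (g m - b)) atTop (𝓝 0) := fun g hg b =>
    h0.comp ((sub_left_injective (b := b)).tendsto_cofinite.comp hg)
  have hpair : ∀ g : ℕ → ℤ, Tendsto g atTop cofinite →
      Tendsto (fun m => statePair u (g m)) atTop (𝓝 0) := by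
    intro g hg
    rw [tendsto_pi_nhds]
    intro i; fin_cases i
    · simpa [statePair] using hstate g hg 0
    · simpa [statePair] using hstate g hg 1
  -- `A m` is the block on `[a, a + q m)`. The block after it stands in for the second factor of
  -- `A²`, the block before it for the matrix inverted in `A⁻¹`.
  have hzero : ∀ a : ℤ, statePair u a = 0 := by
    intro a
    set x : UnitAddCircle := θ + a • (α : UnitAddCircle)
    set A := fun m => transferMatrix f α x E (q m)
    have hmul : Continuous fun M : Matrix (Fin 2) (Fin 2) ℝ => Matrix.mulVec M (statePair u a) :=
      continuous_id.matrix_mulVec continuous_const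
    have hqa : Tendsto (fun m => (q m : ℤ)) atTop cofinite := by
      rw [← Nat.cofinite_eq_atTop] at hq
      exact Nat.cast_injective.tendsto_cofinite.comp (by rwa [Nat.cofinite_eq_atTop] at hq ⊢)
    have h1 : Tendsto (fun m => Matrix.mulVec (A m) (statePair u a)) atTop (𝓝 0) := by
      simp only [A, x, transferMatrix_mulVec_statePair hu]
      exact hpair _ ((add_right_injective a).tendsto_cofinite.comp hqa)
    have hxq : ∀ m, θ + (a + q m) • (α : UnitAddCircle) = x + q m • (α : UnitAddCircle) := by
      intro m; simp only [x, add_smul, natCast_zsmul]; abel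
    have h2 : Tendsto (fun m => Matrix.mulVec (transferMatrix f α (x + q m • (α : UnitAddCircle))
        E (q m)) (Matrix.mulVec (A m) (statePair u a))) atTop (𝓝 0) := by
      simp only [A, x, transferMatrix_mulVec_statePair hu]
      have : ∀ m, Matrix.mulVec (transferMatrix f α (x + q m • (α : UnitAddCircle)) E (q m))
          (statePair u (a + q m)) = statePair u (a + q m + q m) := fun m => by
        rw [← hxq, transferMatrix_mulVec_statePair hu]
      simp only [x] at this
      simp only [this]
      have := ((add_right_injective a).comp (mul_right_injective₀ (two_ne_zero (α := ℤ))))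
      refine (hpair _ (this.tendsto_cofinite.comp hqa)).congr fun m => ?_
      simp only [Function.comp_apply]
      congr 1; ring
    have h2' : Tendsto (fun m => Matrix.mulVec ((transferMatrix f α
        (x + q m • (α : UnitAddCircle)) E (q m) - A m) * A m) (statePair u a)) atTop (𝓝 0) := by
      have : Tendsto (fun m => (transferMatrix f α
          (x + q m • (α : UnitAddCircle)) E (q m) - A m) * A m) atTop (𝓝 0) := by
        have hδC := hδ.mul_const C
        rw [zero_mul] at hδC
        refine squeeze_zero_norm' ?_ hδC
        filter_upwards [hdiff] with m hm
        refine (norm_mul_le _ _).trans ((mul_le_mul (hm x) (hT _ _) (norm_nonneg _)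
          (by positivity)).trans (le_of_eq ?_))
        have : Real.exp (-(q m * c)) * Real.exp (q m * c) = 1 := by
          rw [← Real.exp_add, neg_add_cancel, Real.exp_zero]
        linear_combination
          (K * C ^ 2 * ((q m : ℝ) ^ 2 * Real.exp (-(β - 2 * c) * q m)) * C) * this
      have h := (hmul.tendsto 0).comp this
      rwa [Matrix.zero_mulVec] at h
    have hya : ∀ m, θ + (a + -(q m : ℤ)) • (α : UnitAddCircle) + q m • (α : UnitAddCircle) = x := by
      intro m; simp only [x, add_smul, neg_smul, natCast_zsmul]; abel
    have h3 : Tendsto (fun m => Matrix.mulVec (transferMatrix f α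
        (θ + (a + -(q m : ℤ)) • (α : UnitAddCircle)) E (q m)).adjugate (statePair u a))
        atTop (𝓝 0) := by
      have e : ∀ m, Matrix.mulVec (transferMatrix f α
          (θ + (a + -(q m : ℤ)) • (α : UnitAddCircle)) E (q m)).adjugate (statePair u a) =
          statePair u (a + -(q m : ℤ)) := by
        intro m
        have h := transferMatrix_mulVec_statePair hu (a + -(q m : ℤ)) (q m)
        rw [neg_add_cancel_right] at h
        rw [← h, Matrix.mulVec_mulVec, Matrix.adjugate_mul, det_transferMatrix, one_smul,
          Matrix.one_mulVec]
      simp only [e]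
      exact hpair _ (((add_right_injective a).comp neg_injective).tendsto_cofinite.comp hqa)
    have h3' : Tendsto (fun m => Matrix.mulVec (A m - transferMatrix f α
        (θ + (a + -(q m : ℤ)) • (α : UnitAddCircle)) E (q m)).adjugate (statePair u a))
        atTop (𝓝 0) := by
      have : Tendsto (fun m => (A m - transferMatrix f α
          (θ + (a + -(q m : ℤ)) • (α : UnitAddCircle)) E (q m)).adjugate) atTop (𝓝 0) := by
        refine squeeze_zero_norm' ?_ hδ
        filter_upwards [hdiff] with m hm
        refine (norm_adjugate_le _).trans ?_
        have h := hm (θ + (a + -(q m : ℤ)) • (α : UnitAddCircle))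
        rw [hya] at h
        refine h.trans (mul_le_of_le_one_right (by positivity) ?_)
        rw [Real.exp_le_one_iff]
        have : 0 ≤ q m * c := by positivity
        linarith
      have h := (hmul.tendsto 0).comp this
      rwa [Matrix.zero_mulVec] at h
    refine eq_zero_of_tendsto_mulVec (A := A) (fun m => det_transferMatrix _ _ _ _ _) h1 ?_ ?_
    · refine ((h2.sub h2').congr fun m => ?_).trans (by rw [sub_zero])
      rw [← Matrix.mulVec_mulVec, Matrix.sub_mulVec]
      abel
    · refine ((h3.add h3').congr fun m => ?_).trans (by rw [add_zero])
      rw [← Matrix.add_mulVec]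
      congr 1
      simp only [Matrix.adjugate_fin_two]
      ext i j; fin_cases i <;> fin_cases j <;> simp <;> ring
  funext n
  simpa [statePair] using congrFun (hzero n) 0

end Gordon

end QPS
namespace QPS

/-! ### Cut-off functions -/

/-- The plateau function `x ↦ max(0, min(1, s - (k+1)|x - c|))`. -/
noncomputable def plateau (c s : ℝ) (k : ℕ) : C_c(ℝ, ℝ) where
  toFun x := max 0 (min 1 (s - (k + 1) * |x - c|))
  continuous_toFun := by fun_prop
  hasCompactSupport' := by
    refine HasCompactSupport.intro (isCompact_closedBall c (s / (k + 1))) fun x hx => ?_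
    rw [Metric.mem_closedBall, Real.dist_eq, not_le, div_lt_iff₀ (by positivity)] at hx
    refine max_eq_left ((min_le_right _ _).trans ?_)
    linarith

theorem plateau_apply (c s : ℝ) (k : ℕ) (x : ℝ) :
    plateau c s k x = max 0 (min 1 (s - (k + 1) * |x - c|)) := rfl

theorem plateau_nonneg (c s : ℝ) (k : ℕ) (x : ℝ) : 0 ≤ plateau c s k x := le_max_left _ _

theorem plateau_le_one (c s : ℝ) (k : ℕ) (x : ℝ) : plateau c s k x ≤ 1 :=
  max_le zero_le_one (min_le_left _ _)

theorem plateau_eq_one {c s : ℝ} {k : ℕ} {x : ℝ} (h : (k + 1) * |x - c| ≤ s - 1) :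
    plateau c s k x = 1 := by
  rw [plateau_apply, min_eq_left (by linarith), max_eq_right zero_le_one]

theorem plateau_eq_zero {c s : ℝ} {k : ℕ} {x : ℝ} (h : s ≤ (k + 1) * |x - c|) :
    plateau c s k x = 0 := by
  rw [plateau_apply]
  exact max_eq_left ((min_le_right _ _).trans (by linarith))

theorem plateau_anti (c s : ℝ) {k l : ℕ} (h : k ≤ l) (x : ℝ) :
    plateau c s l x ≤ plateau c s k x := by
  simp only [plateau_apply]
  gcongr

/-! ### Atoms of spectral measures are eigenvalues -/

section Atoms

variable {H : Type*} [NormedAddCommGroup H] [InnerProductSpace ℂ H] [CompleteSpace H]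

theorem norm_cfc_apply_sq {T : H →L[ℂ] H} (h : ℝ → ℝ) (hh : Continuous h) (φ : H) :
    ‖cfc h T φ‖ ^ 2 = (inner ℂ φ (cfc (fun x => h x * h x) T φ)).re := by
  have hs : IsSelfAdjoint (cfc h T) := cfc_predicate h T
  rw [cfc_mul h h T hh.continuousOn hh.continuousOn, mul_apply_eq_comp,
    ← ContinuousLinearMap.adjoint_inner_left, ← ContinuousLinearMap.star_eq_adjoint, hs.star_eq,
    inner_self_eq_norm_sq_to_K]
  norm_cast

theorem inner_cfc_mono {T : H →L[ℂ] H} {g h : ℝ → ℝ} (hg : Continuous g)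
    (hh : Continuous h) (hgh : ∀ x, g x ≤ h x) (φ : H) :
    (inner ℂ φ (cfc g T φ)).re ≤ (inner ℂ φ (cfc h T φ)).re := by
  have h1 : cfc g T ≤ cfc h T :=
    cfc_mono (fun x _ => hgh x) hg.continuousOn hh.continuousOn
  rw [ContinuousLinearMap.le_def] at h1
  have h2 := h1.re_inner_nonneg_right φ
  rw [sub_apply, inner_sub_right, map_sub] at h2
  exact sub_nonneg.1 h2

/-- An atom of a spectral measure is an eigenvalue of the operator. -/
theorem exists_eigenvector_of_spectralMeasure_singleton {T : H →L[ℂ] H} (hT : IsSelfAdjoint T)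
    {φ : H} {e : ℝ} (h : spectralMeasure T φ {e} ≠ 0) :
    ∃ v : H, v ≠ 0 ∧ T v = (e : ℂ) • v := by
  set μ := spectralMeasure T φ
  have : μ.Regular := RealRMK.regular_rieszMeasure _
  -- Tents of height `1` shrinking to `e`: the vectors `g k (T) φ` approximate the projection of `φ`
  -- onto the eigenspace of `e`, and `a k` stays above the mass of the atom.
  set g : ℕ → C_c(ℝ, ℝ) := plateau e 1
  have hgc : ∀ k, Continuous (fun x => g k x) := fun k => (g k).continuous
  set a : ℕ → ℝ := fun k => (inner ℂ φ (cfc (fun x => g k x) T φ)).re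
  have hμ : 0 < μ.real {e} := by
    rw [measureReal_def]
    exact ENNReal.toReal_pos h isCompact_singleton.measure_lt_top.ne
  have ha : ∀ k, μ.real {e} ≤ a k := by
    intro k
    simp only [a]
    rw [← integral_spectralMeasure, ← integral_indicator_one (measurableSet_singleton e)]
    refine integral_mono ?_ ((g k).continuous.integrable_of_hasCompactSupport
      (g k).hasCompactSupport) fun x => ?_
    · exact (integrable_indicator_iff (measurableSet_singleton e)).2
        (integrableOn_const isCompact_singleton.measure_lt_top.ne)
    · by_cases hx : x = e
      · subst hx
        rw [Set.indicator_of_mem (mem_singleton _)]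
        exact (plateau_eq_one (by simp)).ge
      · rw [Set.indicator_of_notMem (by simpa using hx)]
        exact plateau_nonneg _ _ _ _
  have hanti : Antitone a := fun k l hkl =>
    inner_cfc_mono (hgc l) (hgc k) (plateau_anti e 1 hkl) φ
  have hac : CauchySeq a := (tendsto_atTop_ciInf hanti
    ⟨μ.real {e}, by rintro _ ⟨k, rfl⟩; exact ha k⟩).cauchySeq
  set v : ℕ → H := fun k => cfc (fun x => g k x) T φ
  -- As `0 ≤ g k - g l ≤ 1`, its square is at most itself; convergence of the monotone sequence `a`
  -- then makes `v` Cauchy.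
  have hv : ∀ k l, k ≤ l → ‖v k - v l‖ ^ 2 ≤ a k - a l := by
    intro k l hkl
    have e1 : v k - v l = cfc (fun x => g k x - g l x) T φ := by
      rw [cfc_sub _ _ T (hgc k).continuousOn (hgc l).continuousOn]; rfl
    have e2 : a k - a l = (inner ℂ φ (cfc (fun x => g k x - g l x) T φ)).re := by
      rw [cfc_sub _ _ T (hgc k).continuousOn (hgc l).continuousOn,
        sub_apply, inner_sub_right, Complex.sub_re]
    rw [e1, e2, norm_cfc_apply_sq (fun x => g k x - g l x) ((hgc k).sub (hgc l))]
    refine inner_cfc_mono (((hgc k).sub (hgc l)).mul ((hgc k).sub (hgc l)))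
      ((hgc k).sub (hgc l)) (fun x => ?_) φ
    have h1 : 0 ≤ g k x - g l x := sub_nonneg.2 (plateau_anti e 1 hkl x)
    have h2 : g k x - g l x ≤ 1 := by
      linarith [plateau_le_one e 1 k x, plateau_nonneg e 1 l x]
    exact mul_le_of_le_one_left h1 h2
  have hvc : CauchySeq v := by
    rw [Metric.cauchySeq_iff'] at hac ⊢
    intro δ hδ
    obtain ⟨N, hN⟩ := hac (δ ^ 2) (by positivity)
    refine ⟨N, fun n hn => ?_⟩
    have h1 := hv N n hn
    have h2 := hN n hn
    rw [Real.dist_eq, abs_sub_comm] at h2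
    rw [dist_comm, dist_eq_norm]
    exact lt_of_pow_lt_pow_left₀ 2 hδ.le (h1.trans_lt ((le_abs_self _).trans_lt h2))
  obtain ⟨w, hw⟩ := cauchySeq_tendsto_of_complete hvc
  refine ⟨w, ?_, ?_⟩
  · rintro rfl
    have h1 : Tendsto a atTop (𝓝 0) := by
      have := (Complex.continuous_re.tendsto _).comp
        ((tendsto_const_nhds (x := φ)).inner (𝕜 := ℂ) hw)
      rwa [inner_zero_right, Complex.zero_re] at this
    exact absurd (ge_of_tendsto' h1 ha) (not_le.2 hμ)
  · have h1 : Tendsto (fun k => T (v k) - (e : ℂ) • v k) atTop (𝓝 (T w - (e : ℂ) • w)) :=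
      ((T.continuous.tendsto _).comp hw).sub (hw.const_smul _)
    have h2 : Tendsto (fun k => T (v k) - (e : ℂ) • v k) atTop (𝓝 0) := by
      have hlim : Tendsto (fun k : ℕ => 1 / ((k : ℝ) + 1) * ‖φ‖) atTop (𝓝 0) := by
        simpa using tendsto_one_div_add_atTop_nhds_zero_nat.mul_const ‖φ‖
      refine squeeze_zero_norm (fun k => ?_) hlim
      have hc : Continuous fun x : ℝ => x - e := by fun_prop
      have e1 : T (v k) - (e : ℂ) • v k = cfc (fun x => (x - e) * g k x) T φ := by
        rw [cfc_mul _ _ T hc.continuousOn (hgc k).continuousOn,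
          cfc_sub _ _ T (continuousOn_id' _) continuousOn_const, cfc_id' ℝ T,
          cfc_const e T]
        simp [v, Algebra.algebraMap_eq_smul_one]
      rw [e1]
      have hn : ‖cfc (fun x => (x - e) * g k x) T‖ ≤ 1 / ((k : ℝ) + 1) := by
        refine norm_cfc_le (by positivity) fun x _ => ?_
        rw [norm_mul, Real.norm_eq_abs, Real.norm_eq_abs, abs_of_nonneg (plateau_nonneg e 1 k x)]
        rcases le_total 1 ((k + 1 : ℝ) * |x - e|) with h | h
        · rw [plateau_eq_zero h, mul_zero]; positivity
        · rw [le_div_iff₀ (by positivity)]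
          have := plateau_le_one e 1 k x
          have := plateau_nonneg e 1 k x
          have := abs_nonneg (x - e)
          calc |x - e| * g k x * (k + 1) ≤ |x - e| * 1 * (k + 1) := by gcongr
            _ ≤ 1 := by linarith
      exact (ContinuousLinearMap.le_opNorm _ _).trans (by gcongr)
    exact sub_eq_zero.1 (tendsto_nhds_unique h1 h2)

end Atoms

/-! ### Absence of atoms of the canonical measures. -/

theorem tendsto_lp_cofinite (v : L2Z) : Tendsto (fun n => v n) cofinite (𝓝 0) := by
  have h := (memℓp_gen_iff (p := 2) (by norm_num)).1 (lp.memℓp v)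
  have h1 := h.tendsto_cofinite_zero
  simp only [ENNReal.toReal_ofNat, Real.rpow_ofNat] at h1
  rw [tendsto_zero_iff_norm_tendsto_zero]
  simpa using h1.sqrt

/-- The eigenvalue equation has real coefficients, so Gordon's argument applies separately to the
real and imaginary parts of an eigenvector. -/
theorem canonicalMeasure_singleton {f : C(UnitAddCircle, ℝ)} {K : ℝ≥0}
    (hf : LipschitzWith K f) {α : ℝ} (hα : Irrational α) {E β : ℝ} (hβ : 2 * lyapunov f α E < β)
    {p : ℕ → ℤ} {q : ℕ → ℕ} (hq : Tendsto q atTop atTop)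
    (happrox : ∀ m, |α - (p m : ℝ) / (q m : ℝ)| < Real.exp (-β * (q m : ℝ)))
    (θ : UnitAddCircle) : canonicalMeasure f α θ {E} = 0 := by
  have key : ∀ φ, spectralMeasure (quasiperiodicOp f α θ) φ {E} = 0 := by
    intro φ
    by_contra h
    obtain ⟨v, hv0, hv⟩ :=
      exists_eigenvector_of_spectralMeasure_singleton (schrodinger_isSelfAdjoint _) h
    have hrec : ∀ n, v (n - 1) + v (n + 1) + potential f α θ n * v n = E * v n := fun n => by
      rw [← schrodinger_apply]
      exact congrArg (fun w : L2Z => w n) hv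
    have hlim := tendsto_lp_cofinite v
    have hre := eq_zero_of_schrodinger_solution hf hα hβ hq happrox θ (u := fun n => (v n).re)
      (fun n => by simpa using congrArg Complex.re (hrec n))
      ((Complex.continuous_re.tendsto 0).comp hlim)
    have him := eq_zero_of_schrodinger_solution hf hα hβ hq happrox θ (u := fun n => (v n).im)
      (fun n => by simpa using congrArg Complex.im (hrec n))
      ((Complex.continuous_im.tendsto 0).comp hlim)
    refine hv0 (lp.ext (funext fun n => Complex.ext ?_ ?_))
    · simpa using congrFun hre n
    · simpa using congrFun him n
  rw [canonicalMeasure, Measure.add_apply, key, key, add_zero]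

end QPS
namespace QPS

/-! ### Moments of the spectral measures -/

/-- The value at `n` of the `k`-th iterate of the formal Schrödinger operator on `δ_s`. -/
noncomputable def iterDelta (V : ℤ → ℝ) (s : ℤ) : ℕ → ℤ → ℂ
  | 0, n => if n = s then 1 else 0
  | k + 1, n => iterDelta V s k (n - 1) + iterDelta V s k (n + 1) + V n * iterDelta V s k n

theorem tendsto_iterDelta {ι : Type*} {l : Filter ι} {V : ι → ℤ → ℝ} {W : ℤ → ℝ}
    (h : ∀ n, Tendsto (fun i => V i n) l (𝓝 (W n))) (s : ℤ) (k : ℕ) :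
    ∀ n, Tendsto (fun i => iterDelta (V i) s k n) l (𝓝 (iterDelta W s k n)) := by
  induction k with
  | zero => intro n; exact tendsto_const_nhds
  | succ k ih =>
    intro n
    exact ((ih (n - 1)).add (ih (n + 1))).add
      (((Complex.continuous_ofReal.tendsto _).comp (h n)).mul (ih n))

/-- Finite propagation speed. This is what hides the ends of the Floquet block, and with them `ϰ`,
from the low moments. -/
theorem iterDelta_eq_zero (V : ℤ → ℝ) (s : ℤ) (k : ℕ) :
    ∀ n, (k : ℤ) < |n - s| → iterDelta V s k n = 0 := by
  induction k with
  | zero =>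
    intro n hn
    have : n ≠ s := by rintro rfl; simp at hn
    simp [iterDelta, this]
  | succ k ih =>
    intro n hn
    push_cast at hn
    have h1 : (k : ℤ) < |n - 1 - s| := by grind
    have h2 : (k : ℤ) < |n + 1 - s| := by grind
    have h3 : (k : ℤ) < |n - s| := by grind
    simp [iterDelta, ih _ h1, ih _ h2, ih _ h3]

theorem schrodinger_pow_delta (V : ℤ →ᵇ ℝ) (s : ℤ) (k : ℕ) (n : ℤ) :
    (schrodinger V ^ k) (delta s) n = iterDelta V s k n := by
  induction k generalizing n with
  | zero =>
    simp only [pow_zero, iterDelta, delta]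
    rw [one_apply_eq_self, lp.single_apply]
    by_cases h : n = s
    · subst h; simp
    · simp [h]
  | succ k ih =>
    rw [pow_succ', mul_apply_eq_comp, schrodinger_apply, ih, ih, ih]
    rfl

theorem inner_delta_left (s : ℤ) (v : L2Z) : inner ℂ (delta s) v = v s := by
  rw [delta, lp.inner_single_left]
  simp

theorem norm_delta (s : ℤ) : ‖delta s‖ = 1 := by
  rw [delta, lp.norm_single (by norm_num)]
  simp

/-- The constant `4` is larger than necessary and matches `abs_eigenvalues_floquetMatrix_le`, so
that one interval serves both operators. -/
theorem norm_schrodinger_le (V : ℤ →ᵇ ℝ) : ‖schrodinger V‖ ≤ 4 + ‖V‖ := by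
  have ht : ∀ k, ‖translate k‖ ≤ 1 := fun k => LinearMap.mkContinuous_norm_le _ zero_le_one _
  have hm : ‖mulPotential V‖ ≤ ‖V‖ := LinearMap.mkContinuous_norm_le _ (norm_nonneg V) _
  have h1 := norm_add_le (translate (-1) + translate 1) (mulPotential V)
  have h2 := norm_add_le (translate (-1)) (translate 1)
  have h3 := ht (-1)
  have h4 := ht 1
  unfold schrodinger
  linarith

/-- The value of a polynomial at the moments of the spectral measure of `δ_s`. -/
noncomputable def momentSum (V : ℤ → ℝ) (P : Polynomial ℝ) (s : ℤ) : ℝ :=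
  ∑ k ∈ Finset.range (P.natDegree + 1), P.coeff k * (iterDelta V s k s).re

theorem tendsto_momentSum {ι : Type*} {l : Filter ι} {V : ι → ℤ → ℝ} {W : ℤ → ℝ}
    (h : ∀ n, Tendsto (fun i => V i n) l (𝓝 (W n))) (P : Polynomial ℝ) (s : ℤ) :
    Tendsto (fun i => momentSum (V i) P s) l (𝓝 (momentSum W P s)) :=
  tendsto_finsetSum _ fun k _ => ((Complex.continuous_re.tendsto _).comp
    (tendsto_iterDelta h s k s)).const_mul _

/-- The norm of `(g - P)(T)` is controlled by the supremum of `|g - P|` on the spectrum, which lies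
in `[-R, R]`. -/
theorem abs_integral_spectralMeasure_sub_moments_le {H : Type*} [NormedAddCommGroup H]
    [InnerProductSpace ℂ H] [CompleteSpace H] {T : H →L[ℂ] H} (hT : IsSelfAdjoint T) {φ : H}
    (hφ : ‖φ‖ = 1) (g : C_c(ℝ, ℝ)) (P : Polynomial ℝ) {R η : ℝ} (hR : ‖T‖ ≤ R) (hη : 0 ≤ η)
    (hP : ∀ x ∈ Icc (-R) R, |P.eval x - g x| ≤ η) :
    |∫ x, g x ∂(spectralMeasure T φ) - ∑ k ∈ Finset.range (P.natDegree + 1),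
      P.coeff k * (inner ℂ φ ((T ^ k) φ)).re| ≤ η := by
  have e1 : ∑ k ∈ Finset.range (P.natDegree + 1), P.coeff k * (inner ℂ φ ((T ^ k) φ)).re =
      (inner ℂ φ (cfc P.eval T φ)).re := by
    rw [cfc_polynomial P T, Polynomial.aeval_eq_sum_range, sum_apply,
      inner_sum, Complex.re_sum]
    refine Finset.sum_congr rfl fun k _ => ?_
    rw [smul_apply, inner_smul_right_eq_smul, Complex.smul_re, smul_eq_mul]
  rw [integral_spectralMeasure, e1, ← Complex.sub_re, ← inner_sub_right, ← sub_apply,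
    ← cfc_sub (fun x => g x) _ T g.continuous.continuousOn P.continuous.continuousOn]
  refine (Complex.abs_re_le_norm _).trans ((norm_inner_le_norm _ _).trans ?_)
  rw [hφ, one_mul]
  refine (ContinuousLinearMap.le_opNorm _ _).trans ?_
  rw [hφ, mul_one]
  refine norm_cfc_le hη fun x hx => ?_
  rw [Real.norm_eq_abs, abs_sub_comm]
  have : Nontrivial H := ⟨φ, 0, fun h => by simp [h] at hφ⟩
  have h := spectrum.norm_le_norm_of_mem hx
  exact hP x (abs_le.1 (h.trans hR))

theorem abs_integral_spectralMeasure_sub_momentSum_le (V : ℤ →ᵇ ℝ) (s : ℤ) (g : C_c(ℝ, ℝ))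
    (P : Polynomial ℝ) {R η : ℝ} (hR : ‖V‖ ≤ R) (hη : 0 ≤ η)
    (hP : ∀ x ∈ Icc (-(4 + R)) (4 + R), |P.eval x - g x| ≤ η) :
    |∫ x, g x ∂(spectralMeasure (schrodinger V) (delta s)) - momentSum V P s| ≤ η := by
  have h := abs_integral_spectralMeasure_sub_moments_le (schrodinger_isSelfAdjoint V)
    (norm_delta s) g P ((norm_schrodinger_le V).trans (add_le_add_right hR 4)) hη hP
  simpa only [inner_delta_left, schrodinger_pow_delta, momentSum] using h

/-! ### Moments of the Floquet measures -/

theorem floquetMatrix_mulVec (q : ℕ) [NeZero q] (V : ℤ → ℝ) (ϰ : ℝ) (v : Fin q → ℂ) (i : Fin q) :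
    Matrix.mulVec (floquetMatrix q V ϰ) v i =
      V ((i : ℤ) - ((q - 1) / 2 : ℕ)) * v i +
      (if h : (i : ℕ) + 1 < q then v ⟨i + 1, h⟩ else 0) +
      (if 0 < (i : ℕ) then v ⟨i - 1, by omega⟩ else 0) +
      (if (i : ℕ) = 0 then Complex.exp (Complex.I * (q * ϰ)) *
        v ⟨q - 1, Nat.sub_lt (Nat.pos_of_ne_zero (NeZero.ne q)) one_pos⟩ else 0) +
      (if (i : ℕ) + 1 = q then Complex.exp (-(Complex.I * (q * ϰ))) * v 0 else 0) := by
  have hq : 0 < q := Nat.pos_of_ne_zero (NeZero.ne q)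
  simp only [floquetMatrix, Matrix.mulVec, dotProduct, Matrix.of_apply, add_mul,
    Finset.sum_add_distrib, ite_mul, zero_mul, one_mul]
  congr 1
  · congr 1
    · congr 1
      · congr 1
        · simp
        · split_ifs with h
          · rw [Finset.sum_eq_single ⟨i + 1, h⟩]
            · simp
            · intro j _ hj
              rw [if_neg]
              rintro h'
              exact hj (Fin.ext h'.symm)
            · simp
          · refine Finset.sum_eq_zero fun j _ => if_neg fun h' => h (by rw [h']; exact j.2)
      · split_ifs with h
        · rw [Finset.sum_eq_single ⟨i - 1, by omega⟩]
          · rw [if_pos (by simp; omega)]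
          · intro j _ hj
            rw [if_neg]
            rintro h'
            exact hj (Fin.ext (by simp; omega))
          · simp
        · exact Finset.sum_eq_zero fun j _ => if_neg (by omega)
    · split_ifs with h
      · rw [Finset.sum_eq_single ⟨q - 1, by omega⟩]
        · rw [if_pos ⟨h, by simp; omega⟩]
        · intro j _ hj
          rw [if_neg]
          rintro ⟨_, h'⟩
          exact hj (Fin.ext (by simp; omega))
        · simp
      · exact Finset.sum_eq_zero fun j _ => if_neg fun h' => h h'.1
  · split_ifs with h
    · rw [Finset.sum_eq_single 0]
      · rw [if_pos ⟨by simp, h⟩]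
      · intro j _ hj
        rw [if_neg]
        rintro ⟨h', _⟩
        exact hj (Fin.ext (by simpa using h'))
      · simp
    · exact Finset.sum_eq_zero fun j _ => if_neg fun h' => h h'.2

theorem floquetMatrix_pow_mulVec_single {q : ℕ} [NeZero q] (V : ℤ → ℝ) (ϰ : ℝ) {s : ℕ} (k : ℕ)
    (hk : k + s < (q - 1) / 2) (i : Fin q) :
    Matrix.mulVec (floquetMatrix q V ϰ ^ k) (Pi.single (siteIndex q s) 1) i =
      iterDelta V s k ((i : ℤ) - ((q - 1) / 2 : ℕ)) := by
  induction k generalizing i with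
  | zero =>
    have hs : (siteIndex q s : ℕ) = s + (q - 1) / 2 := by
      rw [siteIndex, Fin.val_ofNat, Nat.mod_eq_of_lt (by omega)]
    rw [pow_zero, Matrix.one_mulVec, iterDelta, Pi.single_apply]
    congr 1
    rw [Fin.ext_iff, hs, eq_iff_iff]
    omega
  | succ k ih =>
    have ih' := ih (by omega)
    rw [pow_succ', ← Matrix.mulVec_mulVec, floquetMatrix_mulVec, iterDelta]
    simp only [ih']
    have hz : ∀ n : ℤ, (k : ℤ) < |n - s| → iterDelta V s k n = 0 := iterDelta_eq_zero V s k
    -- The iterate still vanishes at both end sites, which kills the corner terms (`c1`, `c2`), and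
    -- just outside the block, so that missing neighbours cost nothing (`c3`, `c4`).
    have c1 : iterDelta V s k (((0 : Fin q) : ℕ) - ((q - 1) / 2 : ℕ) : ℤ) = 0 := by
      refine hz _ ?_
      rw [Fin.val_zero, lt_abs]; right; push_cast; omega
    have c2 : iterDelta V s k ((q - 1 : ℕ) - ((q - 1) / 2 : ℕ) : ℤ) = 0 := by
      refine hz _ ?_
      rw [lt_abs]; left; omega
    have c3 : (if h : (i : ℕ) + 1 < q then
        iterDelta V s k (((i + 1 : ℕ) : ℤ) - ((q - 1) / 2 : ℕ)) else 0) =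
        iterDelta V s k ((i : ℤ) - ((q - 1) / 2 : ℕ) + 1) := by
      split_ifs with h
      · congr 1; push_cast; ring
      · refine (hz _ ?_).symm
        rw [lt_abs]; left; omega
    have c4 : (if 0 < (i : ℕ) then
        iterDelta V s k (((i - 1 : ℕ) : ℤ) - ((q - 1) / 2 : ℕ)) else 0) =
        iterDelta V s k ((i : ℤ) - ((q - 1) / 2 : ℕ) - 1) := by
      split_ifs with h
      · congr 1; omega
      · refine (hz _ ?_).symm
        rw [lt_abs]; right; omega
    rw [c3, c4, c1, c2]
    simp only [mul_zero, ite_self, add_zero]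
    ring

/-- Read the eigenvector equation at a coordinate of maximal modulus: each of the four off-diagonal
terms is at most that modulus. -/
theorem abs_eigenvalues_floquetMatrix_le (q : ℕ) [NeZero q] (V : ℤ →ᵇ ℝ) (ϰ : ℝ) (j : Fin q) :
    |(floquetMatrix_isHermitian q V ϰ).eigenvalues j| ≤ 4 + ‖V‖ := by
  set hA := floquetMatrix_isHermitian q V ϰ
  set v : Fin q → ℂ := ⇑(hA.eigenvectorBasis j)
  have hv : v ≠ 0 := fun h => hA.eigenvectorBasis.orthonormal.ne_zero j (by ext i; exact congrFun h i)
  obtain ⟨i, -, hi⟩ := Finset.exists_max_image Finset.univ (fun i => ‖v i‖) ⟨0, Finset.mem_univ _⟩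
  have hi0 : 0 < ‖v i‖ := by
    obtain ⟨k, hk⟩ := Function.ne_iff.1 hv
    exact (norm_pos_iff.2 hk).trans_le (hi k (Finset.mem_univ _))
  have h := congrFun (hA.mulVec_eigenvectorBasis j) i
  rw [floquetMatrix_mulVec] at h
  have hM : ∀ k, ‖v k‖ ≤ ‖v i‖ := fun k => hi k (Finset.mem_univ _)
  have he : ∀ t : ℝ, ‖Complex.exp (Complex.I * (q * t))‖ = 1 := fun t => by
    rw [mul_comm]; exact_mod_cast Complex.norm_exp_ofReal_mul_I (q * t)
  have he' : ‖Complex.exp (-(Complex.I * (q * ϰ)))‖ = 1 := by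
    have := he (-ϰ)
    push_cast at this
    rwa [mul_neg, mul_neg] at this
  have h' := congrArg norm h
  rw [Pi.smul_apply, norm_smul, Real.norm_eq_abs] at h'
  refine le_of_mul_le_mul_right ?_ hi0
  change _ = _ * ‖v i‖ at h'
  rw [← h']
  refine (norm_add_le _ _).trans ?_
  have a1 : ‖(V ((i : ℤ) - ((q - 1) / 2 : ℕ)) : ℂ) * v i‖ ≤ ‖V‖ * ‖v i‖ := by
    rw [norm_mul, Complex.norm_real]
    gcongr
    exact V.norm_coe_le_norm _
  have a2 : ‖if h : (i : ℕ) + 1 < q then v ⟨i + 1, h⟩ else 0‖ ≤ ‖v i‖ := by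
    split_ifs
    · exact hM _
    · simp
  have a3 : ‖if 0 < (i : ℕ) then v ⟨i - 1, by omega⟩ else 0‖ ≤ ‖v i‖ := by
    split_ifs
    · exact hM _
    · simp
  have a4 : ‖if (i : ℕ) = 0 then Complex.exp (Complex.I * (q * ϰ)) *
      v ⟨q - 1, Nat.sub_lt (Nat.pos_of_ne_zero (NeZero.ne q)) one_pos⟩ else 0‖ ≤ ‖v i‖ := by
    split_ifs
    · rw [norm_mul, he, one_mul]; exact hM _
    · simp
  have a5 : ‖if (i : ℕ) + 1 = q then Complex.exp (-(Complex.I * (q * ϰ))) * v 0 else 0‖ ≤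
      ‖v i‖ := by
    split_ifs
    · rw [norm_mul, he', one_mul]; exact hM _
    · simp
  have b := norm_add₄_le (a := (V ((i : ℤ) - ((q - 1) / 2 : ℕ)) : ℂ) * v i)
    (b := if h : (i : ℕ) + 1 < q then v ⟨i + 1, h⟩ else 0)
    (c := if 0 < (i : ℕ) then v ⟨i - 1, by omega⟩ else 0)
    (d := if (i : ℕ) = 0 then Complex.exp (Complex.I * (q * ϰ)) *
      v ⟨q - 1, Nat.sub_lt (Nat.pos_of_ne_zero (NeZero.ne q)) one_pos⟩ else 0)
  linarith

/-- Expand the basis vector at `s` in the eigenbasis; its coefficients are the conjugated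
`s`-entries of the eigenvectors. -/
theorem sum_eigenvalues_pow_mul_norm_sq {n : Type*} [Fintype n] [DecidableEq n]
    {A : Matrix n n ℂ} (hA : A.IsHermitian) (k : ℕ) (s : n) :
    ((∑ j, hA.eigenvalues j ^ k * ‖hA.eigenvectorBasis j s‖ ^ 2 : ℝ) : ℂ) =
      Matrix.mulVec (A ^ k) (Pi.single s 1) s := by
  have hpow : ∀ j, Matrix.mulVec (A ^ k) ⇑(hA.eigenvectorBasis j) =
      (hA.eigenvalues j ^ k) • ⇑(hA.eigenvectorBasis j) := by
    intro j
    induction k with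
    | zero => simp
    | succ k ih =>
      rw [pow_succ, ← Matrix.mulVec_mulVec, hA.mulVec_eigenvectorBasis, Matrix.mulVec_smul, ih,
        smul_smul, pow_succ, mul_comm]
  have hb := hA.eigenvectorBasis.sum_repr' (EuclideanSpace.single s (1 : ℂ))
  have hb' : (Pi.single s 1 : n → ℂ) =
      ∑ j, (starRingEnd ℂ (hA.eigenvectorBasis j s)) • ⇑(hA.eigenvectorBasis j) := by
    have h := congrArg (fun x : EuclideanSpace ℂ n => (⇑x : n → ℂ)) hb
    simp only [EuclideanSpace.inner_single_right, one_mul] at h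
    rw [← show (⇑(EuclideanSpace.single s (1 : ℂ)) : n → ℂ) = Pi.single s 1 by
      ext i; simp [Pi.single_apply], ← h]
    simp
  rw [hb', Matrix.mulVec_sum, Finset.sum_apply]
  push_cast
  refine Finset.sum_congr rfl fun j _ => ?_
  rw [Matrix.mulVec_smul, hpow, Pi.smul_apply, Pi.smul_apply, smul_eq_mul, Complex.real_smul,
    ← Complex.conj_mul']
  push_cast
  ring

theorem integral_floquetMeasure (q : ℕ) [NeZero q] (V : ℤ → ℝ) (ϰ : ℝ) (g : ℝ → ℝ) :
    ∫ x, g x ∂(floquetMeasure q V ϰ) =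
      ∑ s ∈ Finset.range 2, ∑ j, g ((floquetMatrix_isHermitian q V ϰ).eigenvalues j) *
        ‖(floquetMatrix_isHermitian q V ϰ).eigenvectorBasis j (siteIndex q s)‖ ^ 2 := by
  rw [floquetMeasure, integral_finsetSum_measure]
  · simp only [integral_smul_measure, integral_dirac, Finset.sum_range_succ, Finset.sum_range_zero,
      zero_add]
    rw [← Finset.sum_add_distrib]
    refine Finset.sum_congr rfl fun j _ => ?_
    rw [ENNReal.toReal_ofReal (by positivity), smul_eq_mul]
    ring
  · intro j _
    exact (integrable_dirac (by simp)).smul_measure ENNReal.ofReal_ne_top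

theorem abs_integral_floquetMeasure_sub_momentSum_le {q : ℕ} [NeZero q] (V : ℤ →ᵇ ℝ) (ϰ : ℝ)
    (g : ℝ → ℝ) (P : Polynomial ℝ) {R η : ℝ} (hR : ‖V‖ ≤ R)
    (hP : ∀ x ∈ Icc (-(4 + R)) (4 + R), |P.eval x - g x| ≤ η)
    (hq : P.natDegree + 1 < (q - 1) / 2) :
    |∫ x, g x ∂(floquetMeasure q V ϰ) - (momentSum V P 0 + momentSum V P 1)| ≤ 2 * η := by
  set hA := floquetMatrix_isHermitian q V ϰ
  have hh : 2 * ((q - 1) / 2) ≤ q - 1 := by omega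
  -- The `+ 1` in `hq` leaves room for the starting site `s = 1`.
  have hm : ∀ s < 2, ∀ k ≤ P.natDegree,
      ∑ j, hA.eigenvalues j ^ k * ‖hA.eigenvectorBasis j (siteIndex q s)‖ ^ 2 =
        (iterDelta V s k s).re := by
    intro s hs k hk
    have hsi : (siteIndex q s : ℕ) = s + (q - 1) / 2 := by
      rw [siteIndex, Fin.val_ofNat, Nat.mod_eq_of_lt (by omega)]
    rw [← Complex.ofReal_re (∑ j, _), sum_eigenvalues_pow_mul_norm_sq,
      floquetMatrix_pow_mulVec_single V ϰ k (by omega), hsi]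
    congr 2
    push_cast; ring
  have key : ∀ s < 2, |∑ j, g (hA.eigenvalues j) * ‖hA.eigenvectorBasis j (siteIndex q s)‖ ^ 2 -
      momentSum V P s| ≤ η := by
    intro s hs
    have e : momentSum V P s = ∑ j, P.eval (hA.eigenvalues j) *
        ‖hA.eigenvectorBasis j (siteIndex q s)‖ ^ 2 := by
      simp only [momentSum, Polynomial.eval_eq_sum_range, Finset.sum_mul]
      rw [Finset.sum_comm]
      refine Finset.sum_congr rfl fun k hk => ?_
      rw [← hm s hs k (by rw [Finset.mem_range] at hk; omega), Finset.mul_sum]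
      exact Finset.sum_congr rfl fun j _ => by ring
    have h1 : ∑ j, ‖hA.eigenvectorBasis j (siteIndex q s)‖ ^ 2 = 1 := by
      simpa [iterDelta] using hm s hs 0 (Nat.zero_le _)
    rw [e, ← Finset.sum_sub_distrib]
    refine (Finset.abs_sum_le_sum_abs _ _).trans ?_
    calc _ ≤ ∑ j, η * ‖hA.eigenvectorBasis j (siteIndex q s)‖ ^ 2 := by
          refine Finset.sum_le_sum fun j _ => ?_
          rw [← sub_mul, abs_mul, abs_of_nonneg (sq_nonneg ‖_‖), abs_sub_comm]
          gcongr
          refine hP _ (abs_le.1 ?_)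
          linarith [abs_eigenvalues_floquetMatrix_le q V ϰ j]
      _ = η := by rw [← Finset.mul_sum, h1, mul_one]
  rw [integral_floquetMeasure, Finset.sum_range_succ, Finset.sum_range_one, add_sub_add_comm]
  refine (abs_add_le _ _).trans ?_
  have h0 := key 0 (by norm_num)
  have h1 := key 1 (by norm_num)
  push_cast at h0 h1
  linarith

end QPS
namespace QPS

/-! ### Weak convergence -/

theorem tendsto_of_approx {ι : Type*} {l : Filter ι} {F : ι → ℝ} {L : ℝ}
    (h : ∀ η > 0, ∃ (G : ι → ℝ) (M : ℝ), (∀ᶠ i in l, |F i - G i| ≤ η) ∧ |L - M| ≤ η ∧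
      Tendsto G l (𝓝 M)) : Tendsto F l (𝓝 L) := by
  rw [Metric.tendsto_nhds]
  intro δ hδ
  obtain ⟨G, M, h1, h2, h3⟩ := h (δ / 4) (by positivity)
  filter_upwards [h1, Metric.tendsto_nhds.1 h3 (δ / 4) (by positivity)] with i hi hi'
  rw [Real.dist_eq] at hi' ⊢
  rw [abs_lt] at hi' ⊢
  rw [abs_le] at hi h2
  constructor <;> linarith

theorem exists_polynomial_near (g : C_c(ℝ, ℝ)) (R : ℝ) {η : ℝ} (hη : 0 < η) :
    ∃ P : Polynomial ℝ, ∀ x ∈ Icc (-R) R, |P.eval x - g x| ≤ η :=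
  (exists_polynomial_near_of_continuousOn (-R) R g g.continuous.continuousOn η hη).imp
    fun _ h x hx => (h x hx).le

theorem abs_integral_canonicalMeasure_sub_le (f : C(UnitAddCircle, ℝ)) (α : ℝ)
    (θ : UnitAddCircle) (g : C_c(ℝ, ℝ)) (P : Polynomial ℝ) {η : ℝ} (hη : 0 ≤ η)
    (hP : ∀ x ∈ Icc (-(4 + ‖f‖)) (4 + ‖f‖), |P.eval x - g x| ≤ η) :
    |∫ x, g x ∂(canonicalMeasure f α θ) -
      (momentSum (potential f α θ) P 0 + momentSum (potential f α θ) P 1)| ≤ 2 * η := by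
  have hV : ‖potential f α θ‖ ≤ ‖f‖ :=
    (BoundedContinuousFunction.norm_le (norm_nonneg _)).2 fun n => f.norm_coe_le_norm _
  have h : ∀ s, _ := fun s =>
    abs_integral_spectralMeasure_sub_momentSum_le (potential f α θ) s g P hV hη hP
  have hint : ∀ φ, Integrable g (spectralMeasure (quasiperiodicOp f α θ) φ) := fun φ => by
    have : (spectralMeasure (quasiperiodicOp f α θ) φ).Regular := RealRMK.regular_rieszMeasure _
    exact g.continuous.integrable_of_hasCompactSupport g.hasCompactSupport
  rw [canonicalMeasure, integral_add_measure (hint _) (hint _), add_sub_add_comm]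
  refine (abs_add_le _ _).trans ?_
  have h0 := h 0
  have h1 := h 1
  unfold quasiperiodicOp
  linarith

theorem tendsto_potential {ι : Type*} {l : Filter ι} (f : C(UnitAddCircle, ℝ)) {a : ι → ℝ}
    {α : ℝ} (ha : Tendsto a l (𝓝 α)) {t : ι → UnitAddCircle} {θ : UnitAddCircle}
    (ht : Tendsto t l (𝓝 θ)) (n : ℤ) :
    Tendsto (fun i => potential f (a i) (t i) n) l (𝓝 (potential f α θ n)) := by
  simp only [potential_apply]
  refine (f.continuous.tendsto _).comp (ht.add ?_)
  exact ((AddCircle.continuous_mk' (1 : ℝ)).tendsto _).comp (ha.const_mul (n : ℝ))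

theorem tendsto_integral_canonicalMeasure {ι : Type*} {l : Filter ι} (f : C(UnitAddCircle, ℝ))
    {a : ι → ℝ} {α : ℝ} (ha : Tendsto a l (𝓝 α)) {t : ι → UnitAddCircle} {θ : UnitAddCircle}
    (ht : Tendsto t l (𝓝 θ)) (g : C_c(ℝ, ℝ)) :
    Tendsto (fun i => ∫ x, g x ∂(canonicalMeasure f (a i) (t i))) l
      (𝓝 (∫ x, g x ∂(canonicalMeasure f α θ))) := by
  refine tendsto_of_approx fun η hη => ?_
  obtain ⟨P, hP⟩ := exists_polynomial_near g (4 + ‖f‖) (half_pos hη)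
  have h : ∀ a t, _ := fun a t =>
    abs_integral_canonicalMeasure_sub_le f a t g P (half_pos hη).le hP
  simp only [mul_div_cancel₀ η (two_ne_zero (α := ℝ))] at h
  exact ⟨_, _, Eventually.of_forall fun i => h (a i) (t i), h α θ,
    (tendsto_momentSum (tendsto_potential f ha ht) P 0).add
      (tendsto_momentSum (tendsto_potential f ha ht) P 1)⟩

/-- No condition ties `ϰ` to the index, because the moment comparison is independent of it;
uniformity in `ϰ` comes from here. -/
theorem tendsto_integral_floquetMeasure {ι : Type*} {l : Filter ι} (f : C(UnitAddCircle, ℝ))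
    {a : ι → ℝ} {α : ℝ} (ha : Tendsto a l (𝓝 α)) {t : ι → UnitAddCircle} {θ : UnitAddCircle}
    (ht : Tendsto t l (𝓝 θ)) {q : ι → ℕ} [∀ i, NeZero (q i)] (hq : Tendsto q l atTop)
    (ϰ : ι → ℝ) (g : C_c(ℝ, ℝ)) :
    Tendsto (fun i => ∫ x, g x ∂(floquetMeasure (q i) (potential f (a i) (t i)) (ϰ i))) l
      (𝓝 (∫ x, g x ∂(canonicalMeasure f α θ))) := by
  refine tendsto_of_approx fun η hη => ?_
  obtain ⟨P, hP⟩ := exists_polynomial_near g (4 + ‖f‖) (half_pos hη)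
  have h := abs_integral_canonicalMeasure_sub_le f α θ g P (half_pos hη).le hP
  rw [mul_div_cancel₀ η (two_ne_zero (α := ℝ))] at h
  refine ⟨_, _, ?_, h, (tendsto_momentSum (tendsto_potential f ha ht) P 0).add
      (tendsto_momentSum (tendsto_potential f ha ht) P 1)⟩
  filter_upwards [hq.eventually_ge_atTop (2 * P.natDegree + 6)] with i hi
  have hV : ‖potential f (a i) (t i)‖ ≤ ‖f‖ :=
    (BoundedContinuousFunction.norm_le (norm_nonneg _)).2 fun n => f.norm_coe_le_norm _
  have h' := abs_integral_floquetMeasure_sub_momentSum_le (q := q i) (potential f (a i) (t i))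
    (ϰ i) g P hV hP (by omega)
  rwa [mul_div_cancel₀ η (two_ne_zero (α := ℝ))] at h'

/-- Vague convergence implies convergence of the measures of balls whose boundary points are not
atoms of the limit. -/
theorem tendsto_measureReal_ball {ι : Type*} {l : Filter ι} {ν : ι → Measure ℝ} {μ : Measure ℝ}
    [∀ i, IsFiniteMeasureOnCompacts (ν i)] [IsFiniteMeasureOnCompacts μ]
    (h : ∀ g : C_c(ℝ, ℝ), Tendsto (fun i => ∫ x, g x ∂(ν i)) l (𝓝 (∫ x, g x ∂μ)))
    {c r : ℝ} (h1 : μ {c - r} = 0) (h2 : μ {c + r} = 0) :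
    Tendsto (fun i => (ν i).real (Metric.ball c r)) l (𝓝 (μ.real (Metric.ball c r))) := by
  set B := Metric.ball c r
  have hB : MeasurableSet B := Metric.isOpen_ball.measurableSet
  have hint : ∀ (ρ : Measure ℝ) [IsFiniteMeasureOnCompacts ρ] (g : C_c(ℝ, ℝ)), Integrable g ρ :=
    fun ρ _ g => g.continuous.integrable_of_hasCompactSupport g.hasCompactSupport
  have hintB : ∀ (ρ : Measure ℝ) [IsFiniteMeasureOnCompacts ρ],
      Integrable (B.indicator (1 : ℝ → ℝ)) ρ := fun ρ _ =>
    (integrable_indicator_iff hB).2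
      (integrableOn_const ((measure_mono Metric.ball_subset_closedBall).trans_lt
        (isCompact_closedBall c r).measure_lt_top).ne)
  -- `g k` vanishes off the ball and is `1` up to radius `r - 1/(k+1)`; `G k` is `1` on the closed
  -- ball and vanishes beyond radius `r + 1/(k+1)`.
  set g := fun k : ℕ => plateau c ((k + 1) * r) k
  set G := fun k : ℕ => plateau c ((k + 1) * r + 1) k
  have hg0 : ∀ k x, x ∉ B → g k x = 0 := fun k x hx => by
    rw [Metric.mem_ball, Real.dist_eq, not_lt] at hx
    exact plateau_eq_zero (by gcongr)
  have hG1 : ∀ k x, |x - c| ≤ r → G k x = 1 := fun k x hx => by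
    refine plateau_eq_one ?_
    rw [add_sub_cancel_right]; gcongr
  have hlow : ∀ (ρ : Measure ℝ) [IsFiniteMeasureOnCompacts ρ] (k : ℕ),
      ∫ x, g k x ∂ρ ≤ ρ.real B := by
    intro ρ _ k
    rw [← integral_indicator_one hB]
    refine integral_mono (hint ρ (g k)) (hintB ρ) fun x => ?_
    by_cases hx : x ∈ B
    · rw [Set.indicator_of_mem hx]; exact plateau_le_one _ _ _ _
    · rw [Set.indicator_of_notMem hx]; exact (hg0 k x hx).le
  have hupp : ∀ (ρ : Measure ℝ) [IsFiniteMeasureOnCompacts ρ] (k : ℕ),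
      ρ.real B ≤ ∫ x, G k x ∂ρ := by
    intro ρ _ k
    rw [← integral_indicator_one hB]
    refine integral_mono (hintB ρ) (hint ρ (G k)) fun x => ?_
    by_cases hx : x ∈ B
    · rw [Set.indicator_of_mem hx]
      rw [Metric.mem_ball, Real.dist_eq] at hx
      exact (hG1 k x hx.le).ge
    · rw [Set.indicator_of_notMem hx]; exact plateau_nonneg _ _ _ _
  have hdom : ∀ (k : ℕ) (d x : ℝ), d ≤ 1 →
      ‖plateau c ((k + 1) * r + d) k x‖ ≤ plateau c (r + 2) 0 x := by
    intro k d x hd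
    rw [Real.norm_eq_abs, abs_of_nonneg (plateau_nonneg _ _ _ _)]
    rcases le_total (|x - c|) (r + 1) with hx | hx
    · refine (plateau_le_one _ _ _ _).trans (plateau_eq_one ?_).ge
      push_cast; linarith
    · rw [plateau_eq_zero]
      · exact plateau_nonneg _ _ _ _
      · have : (0 : ℝ) ≤ k := k.cast_nonneg
        nlinarith
  have hev : ∀ t : ℝ, 0 < t → ∀ᶠ k : ℕ in atTop, 1 ≤ ((k : ℝ) + 1) * t := by
    intro t ht
    filter_upwards [eventually_ge_atTop (Nat.ceil (1 / t))] with k hk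
    have : 1 / t ≤ k := (Nat.le_ceil _).trans (by exact_mod_cast hk)
    rw [div_le_iff₀ ht] at this
    linarith
  have hlim : Tendsto (fun k => ∫ x, g k x ∂μ) atTop (𝓝 (μ.real B)) := by
    rw [← integral_indicator_one hB]
    refine tendsto_integral_of_dominated_convergence (fun x => plateau c (r + 2) 0 x)
      (fun k => (hint μ (g k)).aestronglyMeasurable) (hint μ _)
      (fun k => Eventually.of_forall fun x => ?_) (Eventually.of_forall fun x => ?_)
    · simpa using hdom k 0 x zero_le_one
    · by_cases hx : x ∈ B
      · rw [Set.indicator_of_mem hx]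
        rw [Metric.mem_ball, Real.dist_eq] at hx
        refine tendsto_const_nhds.congr' ?_
        filter_upwards [hev (r - |x - c|) (by linarith)] with k hk
        exact (plateau_eq_one (by linarith)).symm
      · rw [Set.indicator_of_notMem hx]
        exact tendsto_const_nhds.congr fun k => (hg0 k x hx).symm
  have hLim : Tendsto (fun k => ∫ x, G k x ∂μ) atTop (𝓝 (μ.real B)) := by
    rw [← integral_indicator_one hB]
    refine tendsto_integral_of_dominated_convergence (fun x => plateau c (r + 2) 0 x)
      (fun k => (hint μ (G k)).aestronglyMeasurable) (hint μ _)
      (fun k => Eventually.of_forall fun x => hdom k 1 x le_rfl) ?_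
    -- `G k` stays equal to `1` at the endpoints, so its limit is the indicator of the open ball
    -- only off these two null points.
    filter_upwards [compl_mem_ae_iff.2 h1, compl_mem_ae_iff.2 h2] with x hx1 hx2
    by_cases hx : x ∈ B
    · rw [Set.indicator_of_mem hx]
      rw [Metric.mem_ball, Real.dist_eq] at hx
      exact tendsto_const_nhds.congr fun k => (hG1 k x hx.le).symm
    · rw [Set.indicator_of_notMem hx]
      have hx' : r < |x - c| := by
        rw [Metric.mem_ball, Real.dist_eq, not_lt] at hx
        refine lt_of_le_of_ne hx fun he => ?_
        rcases abs_choice (x - c) with ha | ha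
        · exact hx2 (by rw [mem_singleton_iff]; linarith)
        · exact hx1 (by rw [mem_singleton_iff]; linarith)
      refine tendsto_const_nhds.congr' ?_
      filter_upwards [hev (|x - c| - r) (by linarith)] with k hk
      exact (plateau_eq_zero (by linarith)).symm
  refine tendsto_order.2 ⟨fun a ha => ?_, fun a ha => ?_⟩
  · obtain ⟨k, hk⟩ := (hlim.eventually_const_lt ha).exists
    filter_upwards [(h (g k)).eventually_const_lt hk] with i hi
    exact hi.trans_le (hlow (ν i) k)
  · obtain ⟨k, hk⟩ := (hLim.eventually_lt_const ha).exists
    filter_upwards [(h (G k)).eventually_lt_const hk] with i hi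
    exact (hupp (ν i) k).trans_lt hi

/-! ### Finiteness of the measures, growth of denominators, and the bound on `γ` up to the
endpoints. -/

instance (f : C(UnitAddCircle, ℝ)) (α : ℝ) (θ : UnitAddCircle) :
    IsFiniteMeasureOnCompacts (canonicalMeasure f α θ) where
  lt_top_of_isCompact K hK := by
    have h : ∀ φ, spectralMeasure (quasiperiodicOp f α θ) φ K < ∞ := fun φ => by
      have : (spectralMeasure (quasiperiodicOp f α θ) φ).Regular := RealRMK.regular_rieszMeasure _
      exact hK.measure_lt_top
    rw [canonicalMeasure, Measure.add_apply]
    exact ENNReal.add_lt_top.2 ⟨h _, h _⟩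

instance (q : ℕ) [NeZero q] (V : ℤ → ℝ) (ϰ : ℝ) : IsFiniteMeasure (floquetMeasure q V ϰ) := by
  constructor
  rw [floquetMeasure, Measure.finsetSum_apply]
  refine ENNReal.sum_lt_top.2 fun j _ => ?_
  rw [Measure.smul_apply, measure_univ, smul_eq_mul, mul_one]
  exact ENNReal.ofReal_lt_top

/-- An irrational keeps a positive distance from all fractions with denominator at most `b`. -/
theorem tendsto_denominators {α : ℝ} (hα : Irrational α) {p : ℕ → ℤ} {q : ℕ → ℕ}
    (hlim : Tendsto (fun m => (p m : ℝ) / (q m : ℝ)) atTop (𝓝 α)) : Tendsto q atTop atTop := by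
  refine tendsto_atTop.2 fun b => ?_
  obtain ⟨δ, hδ, hδ0⟩ := ((hα.eventually_forall_le_dist_cast_div_of_denom_le b).filter_mono
    nhdsWithin_le_nhds |>.and (self_mem_nhdsWithin (s := Ioi (0 : ℝ)))).exists
  filter_upwards [Metric.tendsto_nhds.1 hlim δ hδ0] with m hm
  by_contra! hb
  exact absurd (hδ (q m) hb.le (p m)) (not_le.2 (by rwa [dist_comm] at hm))

/-- Atoms must be excluded at the endpoints, outside the open ball; continuity extends the bound to
its closure. It also bounds the image, so that `sSup` is a true supremum. -/
theorem two_mul_lyapunov_lt {f : C(UnitAddCircle, ℝ)} {α : ℝ} (hγ : Continuous (lyapunov f α))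
    {E₀ ε β : ℝ} (hε : 0 < ε) (hβ : 2 * sSup (lyapunov f α '' Metric.ball E₀ ε) < β) {E : ℝ}
    (hE : E ∈ Metric.closedBall E₀ ε) : 2 * lyapunov f α E < β := by
  have hbdd : BddAbove (lyapunov f α '' Metric.ball E₀ ε) :=
    ((isCompact_closedBall E₀ ε).image hγ).bddAbove.mono (image_mono Metric.ball_subset_closedBall)
  rw [← closure_ball E₀ hε.ne'] at hE
  have h : lyapunov f α E ≤ sSup (lyapunov f α '' Metric.ball E₀ ε) :=
    closure_minimal (fun x hx => le_csSup hbdd (mem_image_of_mem _ hx))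
      (isClosed_le hγ continuous_const) hE
  linarith

end QPS

/-! ### Uniformity by compactness of the circle. -/

theorem mainTheorem4
    (f : C(UnitAddCircle, ℝ)) (K : ℝ≥0) (hf : LipschitzWith K f)
    (α : ℝ) (hα : Irrational α)
    (hγ : Continuous (QPS.lyapunov f α))
    (E₀ : ℝ) (hE₀ : E₀ ∈ QPS.spectrumSet f α)
    (ε : ℝ) (hε : 0 < ε)
    (β : ℝ) (hβ : 2 * sSup (QPS.lyapunov f α '' Metric.ball E₀ ε) < β)
    (p : ℕ → ℤ) (q : ℕ → ℕ) [∀ m, NeZero (q m)]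
    (hlim : Tendsto (fun m => (p m : ℝ) / (q m : ℝ)) atTop (𝓝 α))
    (happrox : ∀ m, |α - (p m : ℝ) / (q m : ℝ)| < Real.exp (-β * (q m : ℝ))) :
    Tendsto (fun m => ⨆ θ : UnitAddCircle, ⨆ ϰ ∈ Icc (0 : ℝ) (Real.pi / (q m : ℝ)),
        ENNReal.ofReal
          |(QPS.floquetMeasure (q m) (QPS.potential f ((p m : ℝ) / (q m : ℝ)) θ) ϰ).real
              (Metric.ball E₀ ε) -
            (QPS.canonicalMeasure f α θ).real (Metric.ball E₀ ε)|)
      atTop (𝓝 0) ∧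
    Continuous fun θ : UnitAddCircle =>
      (QPS.canonicalMeasure f α θ).real (Metric.ball E₀ ε) := by
  have hq := QPS.tendsto_denominators hα hlim
  have hatom : ∀ E ∈ Metric.closedBall E₀ ε, ∀ θ, QPS.canonicalMeasure f α θ {E} = 0 :=
    fun E hE θ => QPS.canonicalMeasure_singleton hf hα (QPS.two_mul_lyapunov_lt hγ hε hβ hE) hq
      happrox θ
  have hm : E₀ - ε ∈ Metric.closedBall E₀ ε := by simp [abs_of_pos hε]
  have hp : E₀ + ε ∈ Metric.closedBall E₀ ε := by simp [abs_of_pos hε]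
  have hcont : Continuous fun θ : UnitAddCircle =>
      (QPS.canonicalMeasure f α θ).real (Metric.ball E₀ ε) :=
    continuous_iff_continuousAt.2 fun θ => QPS.tendsto_measureReal_ball
      (fun g => QPS.tendsto_integral_canonicalMeasure f tendsto_const_nhds tendsto_id g)
      (hatom _ hm θ) (hatom _ hp θ)
  refine ⟨?_, hcont⟩
  rw [ENNReal.tendsto_nhds_zero]
  intro η hη
  obtain ⟨δ, hδ0, hδη⟩ := ENNReal.lt_iff_exists_nnreal_btwn.1 hη
  have hδ : (0 : ℝ) < δ := by exact_mod_cast hδ0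
  have hloc : ∀ θ₀ : UnitAddCircle, ∀ᶠ z : ℕ × UnitAddCircle in atTop ×ˢ 𝓝 θ₀, ∀ ϰ : ℝ,
      |(QPS.floquetMeasure (q z.1) (QPS.potential f ((p z.1 : ℝ) / (q z.1 : ℝ)) z.2) ϰ).real
          (Metric.ball E₀ ε) - (QPS.canonicalMeasure f α z.2).real (Metric.ball E₀ ε)| < δ := by
    intro θ₀
    -- Treating `ϰ` as a third variable along the filter `⊤` makes "eventually" mean "for every
    -- `ϰ`".
    have hθ : Tendsto (fun z : (ℕ × UnitAddCircle) × ℝ => z.1.2) ((atTop ×ˢ 𝓝 θ₀) ×ˢ ⊤) (𝓝 θ₀) :=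
      tendsto_snd.comp tendsto_fst
    have hn : Tendsto (fun z : (ℕ × UnitAddCircle) × ℝ => z.1.1) ((atTop ×ˢ 𝓝 θ₀) ×ˢ ⊤) atTop :=
      tendsto_fst.comp tendsto_fst
    have h1 := QPS.tendsto_measureReal_ball (fun g => QPS.tendsto_integral_floquetMeasure f
      (hlim.comp hn) hθ (q := fun z => q z.1.1) (hq.comp hn) (fun z => z.2) g) (hatom _ hm θ₀) (hatom _ hp θ₀)
    have h2 := ((h1.sub ((hcont.tendsto θ₀).comp hθ)).abs)
    rw [sub_self, abs_zero] at h2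
    have h3 := h2.eventually_lt_const hδ
    rw [← principal_univ, eventually_prod_principal_iff] at h3
    exact h3.mono fun z hz ϰ => hz ϰ (mem_univ _)
  have hunif : ∀ᶠ m : ℕ in atTop, ∀ θ : UnitAddCircle, ∀ ϰ : ℝ,
      |(QPS.floquetMeasure (q m) (QPS.potential f ((p m : ℝ) / (q m : ℝ)) θ) ϰ).real
          (Metric.ball E₀ ε) - (QPS.canonicalMeasure f α θ).real (Metric.ball E₀ ε)| < δ := by
    -- Finitely many of the neighbourhoods from `hloc` cover the circle, which gives one threshold
    -- for `m`.
    have h := isCompact_univ.mem_prod_nhdsSet_of_forall fun θ₀ (_ : θ₀ ∈ univ) => hloc θ₀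
    rw [nhdsSet_univ, ← principal_univ] at h
    exact (eventually_prod_principal_iff.1 h).mono fun m hm θ => hm θ (mem_univ _)
  filter_upwards [hunif] with m hm
  refine iSup_le fun θ => iSup_le fun ϰ => iSup_le fun _ => ?_
  refine (ENNReal.ofReal_le_ofReal (hm θ ϰ).le).trans ?_
  rw [ENNReal.ofReal_coe_nnreal]
  exact hδη.le
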